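/- Let $k_1,\dots,k_N$ be distinct points with $\operatorname{Im}k_j>0$, and let $f_1,\dots,f_N$ be symmetric invertible complex $2\times2$ matrices. Put $t\theta(k)=xk+2tk^2$, $k_0=-x/(4t)$, $|A|=\sqrt{\operatorname{tr}(A^\dagger A)}$, and $a_\Delta(k)=\prod_{j\in\Delta}\frac{k-k_j}{k-\bar k_j}$ for a finite index set $\Delta$. For $\Delta\subseteq J\subseteq\{1,\dots,N\}$ and data $\sigma=\{(k_j,f_j)\}_{j\in J}$, let $M^\Delta(k;x,t|\sigma)$ be the $4\times4$ matrix function (in $2\times2$ blocks) that is analytic in $k$ away from the points $k_j,\bar k_j$ ($j\in J$), tends to $I$ as $k\to\infty$, and has at these points at most simple poles with $$\operatorname*{Res}_{k=k_j}M^\Delta=\lim_{k\to k_j}M^\Delta N_j,\qquad \operatorname*{Res}_{k=\bar k_j}M^\Delta=-\lim_{k\to\bar k_j}M^\Delta N_j^\dagger ,$$ where $$N_j=\begin{pmatrix}0&0\\ a_\Delta(k_j)^2f_je^{2it\theta(k_j)}&0\end{pmatrix}\ (j\notin\Delta),\qquad N_j=\begin{pmatrix}0&a_\Delta'(k_j)^{-2}f_j^{-1}e^{-2it\theta(k_j)}\\0&0\end{pmatrix}\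 (j\in\Delta).$$ Let $q_{sol}(x,t;\sigma)=2i\lim_{k\to\infty}\bigl(kM^\Delta(k;x,t|\sigma)\bigr)_{UR}$, where $UR$ denotes the upper right $2\times 2$ block. For all real $x,t$ the function $M^\Delta$ exists and is unique, and the limit exists and does not depend on $\Delta$. Let $x_1\le x_2$, $v_1\le v_2$, $S=\{(x,t):x=x_0+vt,\ x_0\in[x_1,x_2],\ v\in[v_1,v_2]\}$, $\mathcal I=[-v_2/4,-v_1/4]$, $\mathcal Z(\mathcal I)=\{k_j:\operatorname{Re}k_j\in\mathcal I\}$, $\Delta_{\mathcal I}^-=\{j:\operatorname{Re}k_j<-v_2/4\}$, $\Delta_{k_0}^-=\{j:\operatorname{Re}k_j<k_0\}$, and $$\mu=\min_{k_j\notin\mathcal Z(\mathcal I)}\operatorname{Im}(k_j)\operatorname{dist}(\operatorname{Re}k_j,\mathcal I)$$ (any real number if every $k_j$ lies in $\mathcal Z(\mathcal I)$). Let $\sigma_d=\{(k_j,f_j)\}_{j=1}^N$ be the full data and $\widehat\sigma_d(\mathcal I)=\{(k_j,a_{\Delta_{\mathcal I}^-}(k_j)^2f_j):k_j\in\mathcal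 Z(\mathcal I)\}$ the reduced data. Then, as $t\to+\infty$ with $(x,t)\in S$: (1) For $\Delta=\Delta_{k_0}^-$, and also for $\Delta=\Delta_{\mathcal I}^-$, with $\Delta'=\{j\in\Delta:k_j\in\mathcal Z(\mathcal I)\}$, $$M^{\Delta}(k;x,t|\sigma_d)=\bigl(I+O(e^{-8\mu t})\bigr)M^{\Delta'}(k;x,t|\widehat\sigma_d(\mathcal I)),$$ uniformly, for every $\delta>0$, in all $k$ that are not among the $k_j,\bar k_j$ and have distance at least $\delta$ from the excluded points $k_j,\bar k_j$, $k_j\notin\mathcal Z(\mathcal I)$. (2) Consequently $q_{sol}(x,t;\sigma_d)=q_{sol}(x,t;\widehat\sigma_d(\mathcal I))+O(e^{-8\mu t})$. The estimates are uniform in $(x,t)\in S$, and the implied constants and the time from which they hold depend on the $f_j$ only through a common bound for all $|f_j|$ and $|f_j^{-1}|$. -/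

import Mathlib

open Filter Topology

noncomputable section

/-- The norm `|A| = √(tr (A† A))` of a complex matrix. -/
def frobNorm {m n : Type*} [Fintype m] [Fintype n] (A : Matrix m n ℂ) : ℝ :=
  Real.sqrt (∑ i, ∑ j, ‖A i j‖ ^ 2)

/-- Complex `4 × 4` matrices written in `2 × 2` blocks. -/
abbrev Mat4 : Type := Matrix (Fin 2 ⊕ Fin 2) (Fin 2 ⊕ Fin 2) ℂ

/-- `t θ(z) = x z + 2 t z²`, where `θ(z) = (x / t) z + 2 z²`. -/
def phase (x t : ℝ) (z : ℂ) : ℂ := (x : ℂ) * z + 2 * (t : ℂ) * z ^ 2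

/-- The Blaschke product `a_Δ(z) = ∏_{j ∈ Δ} (z - k_j) / (z - k̄_j)`. -/
def blaschke {N : ℕ} (k : Fin N → ℂ) (Δ : Finset (Fin N)) (z : ℂ) : ℂ :=
  ∏ j ∈ Δ, (z - k j) / (z - star (k j))

open Classical in
/-- The nilpotent matrix of the residue condition at the eigenvalue `k_j`:
upper triangular, with block `a_Δ'(k_j)⁻² f_j⁻¹ e^{-2itθ(k_j)}`, if `j ∈ Δ`;
lower triangular, with block `a_Δ(k_j)² f_j e^{2itθ(k_j)}`, if `j ∉ Δ`. -/
def residueMatrix {N : ℕ} (k : Fin N → ℂ) (f : Fin N → Matrix (Fin 2) (Fin 2) ℂ)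
    (Δ : Finset (Fin N)) (x t : ℝ) (j : Fin N) : Mat4 :=
  if j ∈ Δ then
    Matrix.fromBlocks 0
      (((deriv (blaschke k Δ) (k j) ^ 2)⁻¹ * Complex.exp (-2 * Complex.I * phase x t (k j))) •
        (f j)⁻¹) 0 0
  else
    Matrix.fromBlocks 0 0
      ((blaschke k Δ (k j) ^ 2 * Complex.exp (2 * Complex.I * phase x t (k j))) • f j) 0

/-- The points `k_j`, `k̄_j` with `j ∈ J`. -/
def poleSet {N : ℕ} (k : Fin N → ℂ) (J : Finset (Fin N)) : Set ℂ :=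
  {z | ∃ j ∈ J, z = k j ∨ z = star (k j)}

/-- `M` has at `p` at most a simple pole, and `Res_{z = p} M = lim_{z → p} M(z) A`. -/
def ResidueCondition (M : ℂ → Mat4) (p : ℂ) (A : Mat4) : Prop :=
  ∃ R : Mat4, Tendsto (fun z => (z - p) • M z) (𝓝[≠] p) (𝓝 R) ∧
    Tendsto (fun z => M z * A) (𝓝[≠] p) (𝓝 R)

/-- `M` solves the reflectionless Riemann-Hilbert problem with the scattering data
`{(k_j, f_j) : j ∈ J}` and the triangularity set `Δ ⊆ J`, at the point `(x, t)`.
For `Δ = ∅` the residue matrices are `(0, 0; f_j e^{2itθ(k_j)}, 0)` at `k_j` and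
`(0, -f_j† e^{-2itθ(k̄_j)}; 0, 0)` at `k̄_j`: this is the basic problem for `M(z | σ_d)`.
In general it is the problem solved by `M^Δ = M a_Δ^{σ₄}`, `σ₄ = diag(1, 1, -1, -1)`. -/
structure IsRHSolution {N : ℕ} (k : Fin N → ℂ) (f : Fin N → Matrix (Fin 2) (Fin 2) ℂ)
    (J Δ : Finset (Fin N)) (x t : ℝ) (M : ℂ → Mat4) : Prop where
  analytic : ∀ a b, DifferentiableOn ℂ (fun z => M z a b) (poleSet k J)ᶜ
  normalized : Tendsto M (cocompact ℂ) (𝓝 1)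
  residue : ∀ j ∈ J, ResidueCondition M (k j) (residueMatrix k f Δ x t j)
  residue_conj : ∀ j ∈ J,
    ResidueCondition M (star (k j)) (-(residueMatrix k f Δ x t j).conjTranspose)

/-- `q = 2i lim_{z → ∞} (z M(z))_{UR}`, where `UR` is the upper right `2 × 2` block. -/
def HasPotential (M : ℂ → Mat4) (q : Matrix (Fin 2) (Fin 2) ℂ) : Prop :=
  Tendsto (fun z => (2 * Complex.I * z) • (M z).toBlocks₁₂) (cocompact ℂ) (𝓝 q)

/-- `q = q_sol(x, t)`, computed from the Riemann-Hilbert problem with data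
`{(k_j, f_j) : j ∈ J}` and triangularity set `Δ`. -/
def IsSolitonSolution {N : ℕ} (k : Fin N → ℂ) (f : Fin N → Matrix (Fin 2) (Fin 2) ℂ)
    (J Δ : Finset (Fin N)) (x t : ℝ) (q : Matrix (Fin 2) (Fin 2) ℂ) : Prop :=
  ∃ M : ℂ → Mat4, IsRHSolution k f J Δ x t M ∧ HasPotential M q

/-- The space-time cone `S(x₁, x₂, v₁, v₂)`. -/
def cone (x₁ x₂ v₁ v₂ : ℝ) : Set (ℝ × ℝ) :=
  {p | ∃ x₀ ∈ Set.Icc x₁ x₂, ∃ v ∈ Set.Icc v₁ v₂, p.1 = x₀ + v * p.2}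

/-- The interval `I = [-v₂/4, -v₁/4]`. -/
def velocityInterval (v₁ v₂ : ℝ) : Set ℝ := Set.Icc (-v₂ / 4) (-v₁ / 4)

open Classical in
/-- The indices of `Z(I)`, that is, of the eigenvalues with `Re k_j ∈ I`. -/
def inside {N : ℕ} (k : Fin N → ℂ) (v₁ v₂ : ℝ) : Finset (Fin N) :=
  Finset.univ.filter fun j => (k j).re ∈ velocityInterval v₁ v₂

open Classical in
/-- The indices of `Z \ Z(I)`, that is, of the excluded eigenvalues. -/
def outside {N : ℕ} (k : Fin N → ℂ) (v₁ v₂ : ℝ) : Finset (Fin N) :=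
  Finset.univ.filter fun j => (k j).re ∉ velocityInterval v₁ v₂

open Classical in
/-- `Δ_c⁻ = {j : Re k_j < c}`. With `c = k₀ = -x/(4t)` this is `Δ_{k₀}⁻`, and with
`c = -v₂/4` it is `Δ_I⁻`. -/
def leftOf {N : ℕ} (k : Fin N → ℂ) (c : ℝ) : Finset (Fin N) :=
  Finset.univ.filter fun j => (k j).re < c

/-- The modulated residue constants `f̂_j = a_{Δ_I⁻}(k_j)² f_j`; those with `j ∈ Z(I)` make up
the reduced data `σ̂_d(I)`. -/
def modulated {N : ℕ} (k : Fin N → ℂ) (f : Fin N → Matrix (Fin 2) (Fin 2) ℂ) (v₂ : ℝ)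
    (j : Fin N) : Matrix (Fin 2) (Fin 2) ℂ :=
  blaschke k (leftOf k (-v₂ / 4)) (k j) ^ 2 • f j

/-- The residue constants are symmetric and invertible. -/
def IsResidueData {N : ℕ} (f : Fin N → Matrix (Fin 2) (Fin 2) ℂ) : Prop :=
  ∀ j, (f j).IsSymm ∧ (f j).det ≠ 0

end

/-!
The solutions `M` are rational in `z`, and everything follows from the Schwarz symmetry of their
residue data: the nilpotent matrix at `k̄_j` is `-N_j†` if the one at `k_j` is `N_j`. Together with
`N_j² = 0` it says that the factors `1 + N_j / (z - k_j)` and `1 - N_j / (z - k_j)`, which carry the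
singularities of `M(z)` and of `M(z̄)†` at `k_j`, cancel in the product `M(z) M(z̄)†`. By
Liouville's theorem that product is constant (`IsPoleSolution.mul_star_eq`). For a solution that
vanishes at infinity the constant is `0`, so `M M† = 0` on the real axis and `M = 0`
(`IsPoleSolution.eq_zero`). Since the residue conditions form a finite square linear system, this
gives existence and uniqueness. Since the argument uses no property of the data but their symmetry,
it also gives, by compactness, a bound for the solution in terms of a bound for the data
(`exists_residue_bound`). The problem with triangularity set `Δ` reduces to the one with `Δ = ∅` by
the factor `a_Δ^{σ₄}`, which tends to `1` at infinity and does not change the potential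
(`IsRHSolution.mul_sigmaPow`).

For the localization, take `Δ = Δ_{k₀}⁻`. Then no exponential in the residue matrices exceeds `1`
in modulus, and those at the excluded eigenvalues are `O(e^{-8μt})` in the cone. For large `t` the
residue matrices at the other eigenvalues are those of the reduced problem. Hence the quotient of
the full and the reduced solution has poles only at the excluded points. The residues of this
quotient are products of bounded matrices with the residue matrices there, so they are
`O(e^{-8μt})` (`exists_factorization`, `exists_localization`), and the quotient is the sum of `1`
and of its principal parts. Passing to the basic problems, this quotient does not depend on the part
of `Δ` in `Z(I)`. This gives the estimate for `Δ_I⁻` as well, although the individual solutions need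
not be bounded there, and the estimate for the potentials.
-/

set_option linter.unusedSectionVars false

/-! ### Liouville's theorem with finitely many punctures -/

lemma exists_differentiable_extension {E : Type*} [NormedAddCommGroup E] [NormedSpace ℂ E]
    [CompleteSpace E] (S : Finset ℂ) (f : ℂ → E)
    (hd : DifferentiableOn ℂ f (S : Set ℂ)ᶜ)
    (h0 : ∀ p ∈ S, Tendsto (fun z => (z - p) • f z) (𝓝[≠] p) (𝓝 0)) :
    ∃ g : ℂ → E, Differentiable ℂ g ∧ ∀ z ∉ S, g z = f z := by
  classical
  induction S using Finset.induction_on generalizing f with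
  | empty => exact ⟨f, by simpa [differentiableOn_univ] using hd, fun _ _ => rfl⟩
  | insert p S hp ih =>
    have hopen : IsOpen (S : Set ℂ)ᶜ := S.finite_toSet.isClosed.isOpen_compl
    have hpS : (S : Set ℂ)ᶜ ∈ 𝓝 p := hopen.mem_nhds (by simpa using hp)
    have hlo : (fun z => f z - f p) =o[𝓝[≠] p] fun z => (z - p)⁻¹ := by
      have h1 : Tendsto (fun z => (z - p) • (f z - f p)) (𝓝[≠] p) (𝓝 0) := by
        have h2 : Tendsto (fun z : ℂ => (z - p) • f p) (𝓝[≠] p) (𝓝 0) := by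
          have : Tendsto (fun z : ℂ => (z - p) • f p) (𝓝 p) (𝓝 ((p - p) • f p)) :=
            ((continuous_id.sub continuous_const).smul continuous_const).tendsto p
          simpa using this.mono_left nhdsWithin_le_nhds
        simpa [smul_sub] using (h0 p (by simp)).sub h2
      have h3 := (Asymptotics.isBigO_refl (fun z : ℂ => (z - p)⁻¹) (𝓝[≠] p)).smul_isLittleO
        ((Asymptotics.isLittleO_one_iff ℂ).2 h1)
      refine h3.congr' ?_ (by simp)
      filter_upwards [self_mem_nhdsWithin] with z hz
      rw [smul_smul, inv_mul_cancel₀ (sub_ne_zero.2 hz), one_smul]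
    have hd' := Complex.differentiableOn_update_limUnder_of_isLittleO hpS
      (hd.mono fun z hz => by simpa [not_or] using ⟨hz.2, hz.1⟩) hlo
    obtain ⟨g, hg, hgf⟩ := ih _ hd' fun q hq => by
      have hqp : q ≠ p := fun h => hp (h ▸ hq)
      refine (h0 q (by simp [hq])).congr' ?_
      filter_upwards [mem_nhdsWithin_of_mem_nhds (isOpen_ne.mem_nhds hqp)] with z hz
      rw [Function.update_of_ne hz]
    refine ⟨g, hg, fun z hz => ?_⟩
    rw [Finset.mem_insert, not_or] at hz
    rw [hgf z hz.2, Function.update_of_ne hz.1]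

/-- A function with finitely many removable singularities and a limit at infinity is constant. -/
lemma eq_of_removable_singularities {E : Type*} [NormedAddCommGroup E] [NormedSpace ℂ E]
    [CompleteSpace E] {S : Set ℂ} (hS : S.Finite) {f : ℂ → E} {c : E}
    (hd : DifferentiableOn ℂ f Sᶜ)
    (h0 : ∀ p ∈ S, Tendsto (fun z => (z - p) • f z) (𝓝[≠] p) (𝓝 0))
    (hc : Tendsto f (cocompact ℂ) (𝓝 c)) : ∀ z ∉ S, f z = c := by
  lift S to Finset ℂ using hS
  obtain ⟨g, hg, hgf⟩ := exists_differentiable_extension S f hd h0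
  intro z hz
  rw [← hgf z hz]
  refine hg.apply_eq_of_tendsto_cocompact z (hc.congr' ?_)
  filter_upwards [S.finite_toSet.isCompact.compl_mem_cocompact] with w hw
  exact (hgf w hw).symm

/-! ### Simple poles with nilpotent residue data -/

section Algebra

variable {𝔸 : Type*} [NormedRing 𝔸] [NormedAlgebra ℂ 𝔸]

/-- Multiplying `M` by `1 - A / (z - p)` removes its singularity at `p`. If `A * A = 0` and the
singularity of `M` at `p` is at most a pole, this says that the pole is at most simple, with
`Res M = lim M A`. -/
def RegularAfter (M : ℂ → 𝔸) (p : ℂ) (A : 𝔸) : Prop :=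
  ∃ L : 𝔸, Tendsto (fun z => M z * (1 - (z - p)⁻¹ • A)) (𝓝[≠] p) (𝓝 L)

lemma tendsto_sub_nhdsNE (p : ℂ) : Tendsto (fun z : ℂ => z - p) (𝓝[≠] p) (𝓝 0) := by
  have : Tendsto (fun z : ℂ => z - p) (𝓝 p) (𝓝 (p - p)) :=
    (continuous_id.sub continuous_const).tendsto p
  simpa using this.mono_left nhdsWithin_le_nhds

lemma RegularAfter.tendsto_residue {M : ℂ → 𝔸} {p : ℂ} {A : 𝔸} (hA : A * A = 0)
    (h : RegularAfter M p A) :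
    ∃ R : 𝔸, Tendsto (fun z => (z - p) • M z) (𝓝[≠] p) (𝓝 R) ∧
      Tendsto (fun z => M z * A) (𝓝[≠] p) (𝓝 R) := by
  obtain ⟨L, hL⟩ := h
  refine ⟨L * A, ?_, ?_⟩
  · have h1 : Tendsto (fun z : ℂ => (z - p) • (1 : 𝔸) + A) (𝓝[≠] p) (𝓝 A) := by
      simpa using ((tendsto_sub_nhdsNE p).smul_const (1 : 𝔸)).add_const A
    refine (hL.mul h1).congr' ?_
    filter_upwards [self_mem_nhdsWithin] with z hz
    have hz' : z - p ≠ 0 := sub_ne_zero.2 hz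
    rw [mul_assoc, sub_mul, mul_add, smul_mul_assoc, mul_add, hA]
    simp [smul_smul, inv_mul_cancel₀ hz']
  · refine (hL.mul_const A).congr fun z => ?_
    rw [mul_assoc, sub_mul, smul_mul_assoc, hA]
    simp

/-- `M` has the principal part `R / (z - p)` at `p`. -/
lemma tendsto_smul_of_principal {M G : ℂ → 𝔸} {p : ℂ} {R : 𝔸}
    (hM : ∀ᶠ z in 𝓝[≠] p, M z = (z - p)⁻¹ • R + G z) (hG : ContinuousAt G p) :
    Tendsto (fun z => (z - p) • M z) (𝓝[≠] p) (𝓝 R) := by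
  have h1 : Tendsto (fun z => R + (z - p) • G z) (𝓝[≠] p) (𝓝 R) := by
    simpa using ((tendsto_sub_nhdsNE p).smul (hG.mono_left nhdsWithin_le_nhds)).const_add R
  refine h1.congr' ?_
  filter_upwards [hM, self_mem_nhdsWithin] with z hz hzp
  rw [hz, smul_add, smul_smul, mul_inv_cancel₀ (sub_ne_zero.2 hzp), one_smul]

/-- The two limits in a residue condition force `Res M = G(p) A`, where `G` is the analytic part of
`M` at `p`. -/
lemma residue_eq_mul {M G : ℂ → 𝔸} {p : ℂ} {A R R' : 𝔸}
    (hM : ∀ᶠ z in 𝓝[≠] p, M z = (z - p)⁻¹ • R + G z) (hG : ContinuousAt G p)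
    (h1 : Tendsto (fun z => (z - p) • M z) (𝓝[≠] p) (𝓝 R'))
    (h2 : Tendsto (fun z => M z * A) (𝓝[≠] p) (𝓝 R')) : R = G p * A := by
  have hRR : R' = R := tendsto_nhds_unique h1 (tendsto_smul_of_principal hM hG)
  subst hRR
  -- otherwise `M A` would have a pole
  have hRA : R' * A = 0 := by
    refine tendsto_nhds_unique (h1.mul_const A) ?_
    simpa [smul_mul_assoc] using (tendsto_sub_nhdsNE p).smul h2
  refine tendsto_nhds_unique h2 ?_
  refine ((hG.mono_left nhdsWithin_le_nhds).mul_const A).congr' ?_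
  filter_upwards [hM] with z hz
  rw [hz, add_mul, smul_mul_assoc, hRA]
  simp

/-- The singularity of `M (1 - A / (z - p))` is that of the difference quotient of `G` at `p`. -/
lemma regularAfter_of_residue_eq {M G : ℂ → 𝔸} {p : ℂ} {A R : 𝔸} (hA : A * A = 0)
    (hM : ∀ᶠ z in 𝓝[≠] p, M z = (z - p)⁻¹ • R + G z) (hG : DifferentiableAt ℂ G p)
    (hR : R = G p * A) : RegularAfter M p A := by
  have hRA : R * A = 0 := by rw [hR, mul_assoc, hA, mul_zero]
  have h1 : Tendsto (slope G p) (𝓝[≠] p) (𝓝 (deriv G p)) :=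
    hasDerivAt_iff_tendsto_slope.1 hG.hasDerivAt
  refine ⟨G p - deriv G p * A, ((hG.continuousAt.mono_left nhdsWithin_le_nhds).sub
    (h1.mul_const A)).congr' ?_⟩
  filter_upwards [hM] with z hz
  rw [hz, mul_sub, mul_one, mul_smul_comm, add_mul, smul_mul_assoc, hRA, slope_def_module,
    smul_mul_assoc, sub_mul, ← hR]
  simp only [smul_zero, zero_add, smul_sub]
  abel

lemma regularAfter_zero_of_continuousAt {M : ℂ → 𝔸} {p : ℂ} (h : ContinuousAt M p) :
    RegularAfter M p 0 :=
  ⟨M p, by simpa using h.tendsto.mono_left nhdsWithin_le_nhds⟩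

/-- If `Q` turns the nilpotent factor for `A` into that for `A'`, up to a convergent factor, then
right multiplication by `Q` turns residue data `A` into residue data `A'`. -/
lemma RegularAfter.mul_right {M Q : ℂ → 𝔸} {p : ℂ} {A A' : 𝔸} (hA : A * A = 0)
    (h : RegularAfter M p A)
    (hQ : ∃ L, Tendsto (fun z => (1 + (z - p)⁻¹ • A) * Q z * (1 - (z - p)⁻¹ • A'))
      (𝓝[≠] p) (𝓝 L)) : RegularAfter (fun z => M z * Q z) p A' := by
  obtain ⟨L, hL⟩ := h
  obtain ⟨L', hL'⟩ := hQ
  refine ⟨L * L', (hL.mul hL').congr fun z => ?_⟩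
  have : (1 - (z - p)⁻¹ • A) * (1 + (z - p)⁻¹ • A) = 1 := by
    simp [sub_mul, mul_add, hA]
  calc _ = M z * ((1 - (z - p)⁻¹ • A) * (1 + (z - p)⁻¹ • A)) * Q z * (1 - (z - p)⁻¹ • A') := by
        simp only [mul_assoc]
    _ = _ := by rw [this, mul_one]

lemma tendsto_star_nhdsNE (p : ℂ) : Tendsto (star : ℂ → ℂ) (𝓝[≠] p) (𝓝[≠] (star p)) := by
  refine tendsto_nhdsWithin_iff.2
    ⟨(continuous_star.tendsto p).mono_left nhdsWithin_le_nhds, ?_⟩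
  filter_upwards [self_mem_nhdsWithin] with z hz
  exact fun h => hz (star_injective h)

lemma tendsto_star_cocompact : Tendsto (star : ℂ → ℂ) (cocompact ℂ) (cocompact ℂ) :=
  (Homeomorph.mk (Equiv.ofBijective (star : ℂ → ℂ) star_involutive.bijective)
    continuous_star (by
      have : (⇑(Equiv.ofBijective (star : ℂ → ℂ) star_involutive.bijective).symm) = star := by
        funext z
        rw [Equiv.symm_apply_eq]
        simp
      rw [Equiv.invFun_as_coe, this]
      exact continuous_star)).isClosedEmbedding.tendsto_cocompact

variable [StarRing 𝔸] [StarModule ℂ 𝔸] [NormedStarGroup 𝔸]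

/-- In `M(z) M'(z̄)†` the poles cancel where the residue data of the two factors are related by
`A' = -A†`, because `(1 + A / (z - p)) (1 - A / (z - p)) = 1`. -/
lemma RegularAfter.tendsto_mul_star {M M' : ℂ → 𝔸} {p : ℂ} {A : 𝔸} (hA : A * A = 0)
    (h : RegularAfter M p A) (h' : RegularAfter M' (star p) (-star A)) :
    ∃ L, Tendsto (fun z => M z * star (M' (star z))) (𝓝[≠] p) (𝓝 L) := by
  obtain ⟨L, hL⟩ := h
  obtain ⟨L', hL'⟩ := h'
  refine ⟨L * star L', (hL.mul ((hL'.comp (tendsto_star_nhdsNE p)).star)).congr fun z => ?_⟩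
  have h1 : (1 - (z - p)⁻¹ • A) * (1 + (z - p)⁻¹ • A) = 1 := by
    simp [sub_mul, mul_add, hA]
  have h2 : star (M' (star z) * (1 - (star z - star p)⁻¹ • (-star A))) =
      (1 + (z - p)⁻¹ • A) * star (M' (star z)) := by
    simp [star_mul, star_smul, sub_neg_eq_add]
  simp only [Function.comp_apply]
  rw [h2, ← mul_assoc, mul_assoc (M z), h1, mul_one]

end Algebra

/-! ### Reflectionless Riemann-Hilbert problems in a normed star algebra -/

section PoleProblem

variable {ι 𝔸 : Type*} [Fintype ι] [NormedRing 𝔸] [NormedAlgebra ℂ 𝔸]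

/-- `M` is analytic off the points `p a`, tends to `B` at infinity, and has residue data `A a` at
`p a`. -/
structure IsPoleSolution (p : ι → ℂ) (A : ι → 𝔸) (B : 𝔸) (M : ℂ → 𝔸) : Prop where
  differentiableOn : DifferentiableOn ℂ M (Set.range p)ᶜ
  tendsto : Tendsto M (cocompact ℂ) (𝓝 B)
  regular : ∀ a, RegularAfter M (p a) (A a)

/-- The rational function `B + ∑ X_a / (z - p_a)`. -/
noncomputable def partialFractions (p : ι → ℂ) (B : 𝔸) (X : ι → 𝔸) (z : ℂ) : 𝔸 :=
  B + ∑ a, (z - p a)⁻¹ • X a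

open Classical in
/-- The function `B + ∑ X_b / (z - p_b)` without its principal part at `p_a`, evaluated at `p_a`.
-/
noncomputable def regularValue (p : ι → ℂ) (B : 𝔸) (X : ι → 𝔸) (a : ι) : 𝔸 :=
  B + ∑ b ∈ Finset.univ.erase a, (p a - p b)⁻¹ • X b

lemma isOpen_compl_range (p : ι → ℂ) : IsOpen (Set.range p)ᶜ :=
  (Set.finite_range p).isClosed.isOpen_compl

lemma eventually_notMem_range (p : ι → ℂ) (w : ℂ) : ∀ᶠ z in 𝓝[≠] w, z ∉ Set.range p := by
  have h : IsOpen (Set.range p \ {w})ᶜ :=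
    ((Set.finite_range p).subset Set.sdiff_subset).isClosed.isOpen_compl
  filter_upwards [mem_nhdsWithin_of_mem_nhds (h.mem_nhds (x := w) (by simp)),
    self_mem_nhdsWithin] with z hz hzw hzr
  exact hz ⟨hzr, hzw⟩

lemma eventually_notMem_range_cocompact (p : ι → ℂ) :
    ∀ᶠ z in cocompact ℂ, z ∉ Set.range p :=
  (Set.finite_range p).isCompact.compl_mem_cocompact

lemma tendsto_sub_inv_cocompact (p : ℂ) :
    Tendsto (fun z : ℂ => (z - p)⁻¹) (cocompact ℂ) (𝓝 0) := by
  rw [← Metric.cobounded_eq_cocompact]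
  exact tendsto_inv₀_cobounded.comp (by simp [sub_eq_add_neg])

lemma tendsto_mul_sub_inv_cocompact (p : ℂ) :
    Tendsto (fun z : ℂ => z * (z - p)⁻¹) (cocompact ℂ) (𝓝 1) := by
  have h : Tendsto (fun z : ℂ => 1 + p * (z - p)⁻¹) (cocompact ℂ) (𝓝 1) := by
    simpa using ((tendsto_sub_inv_cocompact p).const_mul p).const_add 1
  refine h.congr' ?_
  filter_upwards [(isCompact_singleton (x := p)).compl_mem_cocompact] with z hz
  have : z - p ≠ 0 := sub_ne_zero.2 hz
  field_simp
  ring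

lemma differentiableAt_sub_inv {p z : ℂ} (h : z ≠ p) :
    DifferentiableAt ℂ (fun z : ℂ => (z - p)⁻¹) z :=
  (differentiableAt_id.sub_const p).inv (sub_ne_zero.2 h)

lemma partialFractions_differentiableOn (p : ι → ℂ) (B : 𝔸) (X : ι → 𝔸) :
    DifferentiableOn ℂ (partialFractions p B X) (Set.range p)ᶜ := by
  intro z hz
  refine (DifferentiableAt.const_add _
    (DifferentiableAt.fun_sum fun a _ => ?_)).differentiableWithinAt
  exact (differentiableAt_sub_inv fun h => hz ⟨a, h.symm⟩).smul_const _

lemma partialFractions_tendsto (p : ι → ℂ) (B : 𝔸) (X : ι → 𝔸) :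
    Tendsto (partialFractions p B X) (cocompact ℂ) (𝓝 B) := by
  have : Tendsto (fun z => ∑ a, (z - p a)⁻¹ • X a) (cocompact ℂ) (𝓝 (∑ a, (0 : ℂ) • X a)) :=
    tendsto_finsetSum _ fun a _ => (tendsto_sub_inv_cocompact (p a)).smul_const (X a)
  have h := this.const_add B
  simp only [zero_smul, Finset.sum_const_zero, add_zero] at h
  exact h

/-- Near `p a`, a sum of partial fractions is its principal part plus an analytic function. -/
lemma partialFractions_principal {p : ι → ℂ} (hp : Function.Injective p) (B : 𝔸) (X : ι → 𝔸)
    (a : ι) : ∃ G : ℂ → 𝔸, DifferentiableAt ℂ G (p a) ∧ G (p a) = regularValue p B X a ∧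
      ∀ z, partialFractions p B X z = (z - p a)⁻¹ • X a + G z := by
  classical
  refine ⟨fun z => B + ∑ b ∈ Finset.univ.erase a, (z - p b)⁻¹ • X b, ?_, ?_, fun z => ?_⟩
  · refine DifferentiableAt.const_add _ (DifferentiableAt.fun_sum fun b hb => ?_)
    exact (differentiableAt_sub_inv fun h => (Finset.mem_erase.1 hb).1 (hp h).symm).smul_const _
  · simp only [regularValue]
  · rw [partialFractions, ← Finset.add_sum_erase _ _ (Finset.mem_univ a), add_left_comm]

/-- The residue conditions for a sum of partial fractions form a linear system. -/
lemma isPoleSolution_partialFractions {p : ι → ℂ} (hp : Function.Injective p) {A : ι → 𝔸}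
    (hA : ∀ a, A a * A a = 0) {B : 𝔸} {X : ι → 𝔸}
    (hX : ∀ a, X a = regularValue p B X a * A a) :
    IsPoleSolution p A B (partialFractions p B X) where
  differentiableOn := partialFractions_differentiableOn p B X
  tendsto := partialFractions_tendsto p B X
  regular a := by
    obtain ⟨G, hG, hGa, h⟩ := partialFractions_principal hp B X a
    exact regularAfter_of_residue_eq (hA a) (Eventually.of_forall h) hG (by rw [hGa, ← hX a])

/-- A function with at most simple poles is the sum of its principal parts and of its limit at
infinity. -/
lemma eq_partialFractions [CompleteSpace 𝔸] {p : ι → ℂ} (hp : Function.Injective p) {B : 𝔸}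
    {X : ι → 𝔸} {M : ℂ → 𝔸} (hd : DifferentiableOn ℂ M (Set.range p)ᶜ)
    (hB : Tendsto M (cocompact ℂ) (𝓝 B))
    (hX : ∀ a, Tendsto (fun z => (z - p a) • M z) (𝓝[≠] (p a)) (𝓝 (X a))) :
    ∀ z ∉ Set.range p, M z = partialFractions p B X z := by
  intro z hz
  have h := eq_of_removable_singularities (Set.finite_range p)
    (f := fun z => M z - partialFractions p B X z) (c := 0)
    (hd.sub (partialFractions_differentiableOn p B X)) (by
      rintro _ ⟨a, rfl⟩
      obtain ⟨G, hG, -, h⟩ := partialFractions_principal hp B X a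
      simpa [smul_sub] using (hX a).sub
        (tendsto_smul_of_principal (Eventually.of_forall h) hG.continuousAt))
    (by simpa using hB.sub (partialFractions_tendsto p B X)) z hz
  exact sub_eq_zero.1 h

/-- A solution is a sum of partial fractions whose coefficients solve the linear system. -/
lemma IsPoleSolution.exists_partialFractions [CompleteSpace 𝔸] {p : ι → ℂ}
    (hp : Function.Injective p) {A : ι → 𝔸} (hA : ∀ a, A a * A a = 0) {B : 𝔸} {M : ℂ → 𝔸}
    (hM : IsPoleSolution p A B M) :
    ∃ X : ι → 𝔸, (∀ a, X a = regularValue p B X a * A a) ∧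
      ∀ z ∉ Set.range p, M z = partialFractions p B X z := by
  choose X hX hX' using fun a => (hM.regular a).tendsto_residue (hA a)
  have h := eq_partialFractions hp hM.differentiableOn hM.tendsto hX
  refine ⟨X, fun a => ?_, h⟩
  obtain ⟨G, hG, hGa, hMG⟩ := partialFractions_principal hp B X a
  rw [← hGa]
  refine residue_eq_mul ?_ hG.continuousAt (hX a) (hX' a)
  filter_upwards [eventually_notMem_range p (p a)] with z hz
  rw [h z hz, hMG]

/-- The limits `Res M = lim M A` at the poles imply the regularity of `M (1 - A / (z - p))`. -/
lemma isPoleSolution_of_residues [CompleteSpace 𝔸] {p : ι → ℂ} (hp : Function.Injective p)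
    {A : ι → 𝔸} (hA : ∀ a, A a * A a = 0) {B : 𝔸} {M : ℂ → 𝔸}
    (hd : DifferentiableOn ℂ M (Set.range p)ᶜ) (hB : Tendsto M (cocompact ℂ) (𝓝 B))
    (hres : ∀ a, ∃ R : 𝔸, Tendsto (fun z => (z - p a) • M z) (𝓝[≠] (p a)) (𝓝 R) ∧
      Tendsto (fun z => M z * A a) (𝓝[≠] (p a)) (𝓝 R)) : IsPoleSolution p A B M := by
  choose X hX hX' using hres
  have h := eq_partialFractions hp hd hB hX
  refine ⟨hd, hB, fun a => ?_⟩
  obtain ⟨G, hG, -, hMG⟩ := partialFractions_principal hp B X a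
  have hM : ∀ᶠ z in 𝓝[≠] (p a), M z = (z - p a)⁻¹ • X a + G z := by
    filter_upwards [eventually_notMem_range p (p a)] with z hz
    rw [h z hz, hMG]
  exact regularAfter_of_residue_eq (hA a) hM hG
    (residue_eq_mul hM hG.continuousAt (hX a) (hX' a))

lemma IsPoleSolution.sub {p : ι → ℂ} {A : ι → 𝔸} {B B' : 𝔸} {M M' : ℂ → 𝔸}
    (h : IsPoleSolution p A B M) (h' : IsPoleSolution p A B' M') :
    IsPoleSolution p A (B - B') (fun z => M z - M' z) where
  differentiableOn := h.differentiableOn.sub h'.differentiableOn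
  tendsto := h.tendsto.sub h'.tendsto
  regular a := by
    obtain ⟨L, hL⟩ := h.regular a
    obtain ⟨L', hL'⟩ := h'.regular a
    exact ⟨L - L', (hL.sub hL').congr fun z => by rw [sub_mul]⟩

/-! ### Schwarz symmetry and the vanishing lemma -/

variable [StarRing 𝔸]

/-- Residue data with Schwarz symmetry: the poles are non-real and are exchanged in conjugate
pairs by `τ`, and the nilpotent residue data satisfy `A_{τ a} = -A_a†`. -/
structure IsSchwarzData (p : ι → ℂ) (τ : ι → ι) (A : ι → 𝔸) : Prop where
  injective : Function.Injective p
  im_ne_zero : ∀ a, (p a).im ≠ 0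
  conj : ∀ a, p (τ a) = star (p a)
  sq : ∀ a, A a * A a = 0
  skew : ∀ a, A (τ a) = -star (A a)

lemma IsSchwarzData.star_mem {p : ι → ℂ} {τ : ι → ι} {A : ι → 𝔸} (h : IsSchwarzData p τ A)
    {z : ℂ} : star z ∈ Set.range p ↔ z ∈ Set.range p := by
  constructor
  · rintro ⟨a, ha⟩
    exact ⟨τ a, by rw [h.conj, ha, star_star]⟩
  · rintro ⟨a, rfl⟩
    exact ⟨τ a, h.conj a⟩

variable [StarModule ℂ 𝔸] [NormedStarGroup 𝔸] [FiniteDimensional ℂ 𝔸]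

lemma differentiableOn_mul_star {p : ι → ℂ} {τ : ι → ι} {A : ι → 𝔸} (h : IsSchwarzData p τ A)
    {M M' : ℂ → 𝔸} (hM : DifferentiableOn ℂ M (Set.range p)ᶜ)
    (hM' : DifferentiableOn ℂ M' (Set.range p)ᶜ) :
    DifferentiableOn ℂ (fun z => M z * star (M' (star z))) (Set.range p)ᶜ := by
  refine hM.mul fun z hz => ?_
  have hz' : star z ∈ (Set.range p)ᶜ := fun h' => hz (h.star_mem.1 h')
  have h1 : DifferentiableAt ℂ M' ((starRingEnd ℂ) z) :=
    (hM' _ hz').differentiableAt ((isOpen_compl_range p).mem_nhds hz')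
  have h2 := h1.star_star
  rw [starRingEnd_apply, star_star] at h2
  exact h2.differentiableWithinAt

/-- `M(z) M'(z̄)†` is constant for two solutions with the same data: its poles cancel. -/
lemma IsPoleSolution.mul_star_eq {p : ι → ℂ} {τ : ι → ι} {A : ι → 𝔸} (h : IsSchwarzData p τ A)
    {B B' : 𝔸} {M M' : ℂ → 𝔸} (hM : IsPoleSolution p A B M) (hM' : IsPoleSolution p A B' M') :
    ∀ z ∉ Set.range p, M z * star (M' (star z)) = B * star B' := by
  have : CompleteSpace 𝔸 := FiniteDimensional.complete ℂ 𝔸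
  refine eq_of_removable_singularities (Set.finite_range p)
    (differentiableOn_mul_star h hM.differentiableOn hM'.differentiableOn) ?_
    (hM.tendsto.mul (hM'.tendsto.comp tendsto_star_cocompact).star)
  rintro _ ⟨a, rfl⟩
  obtain ⟨L, hL⟩ := (hM.regular a).tendsto_mul_star (M' := M') (h.sq a) (by
    rw [← h.conj, ← h.skew]; exact hM'.regular (τ a))
  simpa using (tendsto_sub_nhdsNE (p a)).smul hL

/-- The vanishing lemma: a solution that tends to `0` at infinity is `0`. Indeed `M(z) M(z̄)†`
vanishes, so that `M M† = 0` on the real axis. -/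
lemma IsPoleSolution.eq_zero (hstar : ∀ x : 𝔸, x * star x = 0 → x = 0) {p : ι → ℂ} {τ : ι → ι}
    {A : ι → 𝔸} (h : IsSchwarzData p τ A) {M : ℂ → 𝔸} (hM : IsPoleSolution p A 0 M) :
    ∀ z ∉ Set.range p, M z = 0 := by
  have : CompleteSpace 𝔸 := FiniteDimensional.complete ℂ 𝔸
  have hreal : ∀ x : ℝ, (x : ℂ) ∉ Set.range p := by
    rintro x ⟨a, ha⟩
    exact h.im_ne_zero a (by simp [ha])
  have hzero : ∀ x : ℝ, M x = 0 := fun x => by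
    have := hM.mul_star_eq h hM x (hreal x)
    rw [show star (x : ℂ) = x from Complex.conj_ofReal x, zero_mul] at this
    exact hstar _ this
  have hopen := isOpen_compl_range p
  have hconn : IsPreconnected (Set.range p)ᶜ :=
    ((Set.finite_range p).countable.isPathConnected_compl_of_one_lt_rank (by
      rw [Complex.rank_real_complex]; norm_num)).isConnected.isPreconnected
  have hfreq : ∃ᶠ z in 𝓝[≠] ((0 : ℝ) : ℂ), M z = 0 := by
    have h1 : Tendsto (fun x : ℝ => (x : ℂ)) (𝓝[≠] 0) (𝓝[≠] ((0 : ℝ) : ℂ)) := by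
      refine tendsto_nhdsWithin_iff.2
        ⟨(Complex.continuous_ofReal.tendsto 0).mono_left nhdsWithin_le_nhds, ?_⟩
      filter_upwards [self_mem_nhdsWithin] with x hx
      simpa using hx
    exact h1.frequently (Frequently.of_forall hzero)
  have hanalytic := hM.differentiableOn.analyticOnNhd hopen
  exact fun z hz => hanalytic.eqOn_zero_of_preconnected_of_frequently_eq_zero
    hconn (hreal 0) hfreq hz

lemma IsPoleSolution.unique (hstar : ∀ x : 𝔸, x * star x = 0 → x = 0) {p : ι → ℂ} {τ : ι → ι}
    {A : ι → 𝔸} (h : IsSchwarzData p τ A) {B : 𝔸} {M M' : ℂ → 𝔸} (hM : IsPoleSolution p A B M)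
    (hM' : IsPoleSolution p A B M') : ∀ z ∉ Set.range p, M z = M' z := fun z hz =>
  sub_eq_zero.1 (IsPoleSolution.eq_zero hstar h (by simpa using hM.sub hM') z hz)

/-! ### Existence and uniform bounds -/

open Classical in
/-- The linear operator `X ↦ (X_a - (∑_{b ≠ a} X_b / (p_a - p_b)) A_a)_a` of the residue system. -/
noncomputable def residueOperator (p : ι → ℂ) (A : ι → 𝔸) : (ι → 𝔸) →ₗ[ℂ] (ι → 𝔸) where
  toFun X a := X a - (∑ b ∈ Finset.univ.erase a, (p a - p b)⁻¹ • X b) * A a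
  map_add' X Y := by
    funext a
    simp only [Pi.add_apply, smul_add, Finset.sum_add_distrib, add_mul]
    abel
  map_smul' c X := by
    funext a
    simp only [Pi.smul_apply, RingHom.id_apply, smul_sub, ← smul_mul_assoc, Finset.smul_sum,
      smul_comm c]

lemma residueOperator_eq_iff {p : ι → ℂ} {A X : ι → 𝔸} {B : 𝔸} :
    (residueOperator p A X = fun a => B * A a) ↔ ∀ a, X a = regularValue p B X a * A a := by
  simp only [funext_iff, residueOperator, LinearMap.coe_mk, AddHom.coe_mk, regularValue, add_mul,
    sub_eq_iff_eq_add]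

lemma residueOperator_injective (hstar : ∀ x : 𝔸, x * star x = 0 → x = 0) {p : ι → ℂ} {τ : ι → ι}
    {A : ι → 𝔸} (h : IsSchwarzData p τ A) {X : ι → 𝔸} (hX : residueOperator p A X = 0) :
    X = 0 := by
  have hX' : ∀ a, X a = regularValue p 0 X a * A a :=
    residueOperator_eq_iff.1 (by rw [hX]; funext a; simp)
  have h0 := (isPoleSolution_partialFractions h.injective h.sq hX').eq_zero hstar h
  funext a
  obtain ⟨G, hG, -, hMG⟩ := partialFractions_principal h.injective 0 X a
  refine tendsto_nhds_unique
    (tendsto_smul_of_principal (Eventually.of_forall hMG) hG.continuousAt) ?_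
  refine tendsto_const_nhds.congr' ?_
  filter_upwards [eventually_notMem_range p (p a)] with z hz
  simp [h0 z hz]

/-- Uniqueness for the square residue system implies existence. -/
lemma exists_isPoleSolution (hstar : ∀ x : 𝔸, x * star x = 0 → x = 0) {p : ι → ℂ} {τ : ι → ι}
    {A : ι → 𝔸} (h : IsSchwarzData p τ A) (B : 𝔸) :
    ∃ X : ι → 𝔸, (∀ a, X a = regularValue p B X a * A a) ∧
      IsPoleSolution p A B (partialFractions p B X) := by
  have hinj : Function.Injective (residueOperator p A) :=
    (injective_iff_map_eq_zero _).2 fun X hX => residueOperator_injective hstar h hX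
  obtain ⟨X, hX⟩ := LinearMap.injective_iff_surjective.1 hinj fun a => B * A a
  have hX' := residueOperator_eq_iff.1 hX
  exact ⟨X, hX', isPoleSolution_partialFractions h.injective h.sq hX'⟩

/-- Bounded residue data have bounded solutions: the residue system is invertible for all data
with Schwarz symmetry, and bounded data with this symmetry form a compact set. -/
lemma exists_residue_bound (hstar : ∀ x : 𝔸, x * star x = 0 → x = 0) (p : ι → ℂ) (τ : ι → ι)
    (K : ℝ) : ∃ C : ℝ, 0 ≤ C ∧ ∀ A : ι → 𝔸, IsSchwarzData p τ A → (∀ a, ‖A a‖ ≤ K) →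
      ∀ X : ι → 𝔸, (∀ a, X a = regularValue p 1 X a * A a) → ∀ a, ‖X a‖ ≤ C := by
  classical
  by_cases hne : ∃ A : ι → 𝔸, IsSchwarzData p τ A
  swap
  · exact ⟨0, le_rfl, fun A hA => absurd ⟨A, hA⟩ hne⟩
  obtain ⟨A₀, hA₀⟩ := hne
  have : ProperSpace (ι → 𝔸) := FiniteDimensional.proper ℂ (ι → 𝔸)
  -- `‖L_A X‖` has a positive minimum over all admissible `A` and all unit vectors `X`
  set S : Set ((ι → 𝔸) × (ι → 𝔸)) :=
    ({A | (∀ a, A a * A a = 0) ∧ ∀ a, A (τ a) = -star (A a)} ∩ Metric.closedBall 0 (max K 0)) ×ˢ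
      Metric.sphere 0 1 with hS
  have hcompact : IsCompact S := by
    refine IsCompact.prod ((isCompact_closedBall _ _).inter_left ?_) (isCompact_sphere _ _)
    rw [Set.ofPred_and]
    refine IsClosed.inter ?_ ?_
    · rw [Set.ofPred_forall]
      exact isClosed_iInter fun a => isClosed_eq (by fun_prop) continuous_const
    · rw [Set.ofPred_forall]
      exact isClosed_iInter fun a => isClosed_eq (by fun_prop)
        ((continuous_apply a).star.neg)
  have hcont : Continuous fun q : (ι → 𝔸) × (ι → 𝔸) => ‖residueOperator p q.1 q.2‖ := by
    refine continuous_norm.comp (continuous_pi fun a => ?_)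
    simp only [residueOperator, LinearMap.coe_mk, AddHom.coe_mk]
    fun_prop
  obtain ⟨m, hm, hmin⟩ := hcompact.exists_forall_le' hcont.continuousOn (a := 0) (by
    rintro ⟨A, X⟩ ⟨⟨⟨h1, h2⟩, -⟩, hX⟩
    refine norm_pos_iff.2 fun h0 => ?_
    have hXz := residueOperator_injective hstar
      ⟨hA₀.injective, hA₀.im_ne_zero, hA₀.conj, h1, h2⟩ h0
    have hXz' : X = 0 := hXz
    simp [hXz'] at hX)
  refine ⟨max K 0 / m, by positivity, fun A hA hAK X hX a => ?_⟩
  have hAn : ‖A‖ ≤ max K 0 :=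
    (pi_norm_le_iff_of_nonneg (le_max_right _ _)).2 fun a => (hAK a).trans (le_max_left _ _)
  have hXA : residueOperator p A X = A := by
    simpa using residueOperator_eq_iff.2 hX
  refine (norm_le_pi_norm X a).trans ?_
  rcases eq_or_ne X 0 with rfl | hX0
  · rw [norm_zero]; positivity
  have hXpos : 0 < ‖X‖ := norm_pos_iff.2 hX0
  have h1 := hmin (A, ((‖X‖⁻¹ : ℝ) : ℂ) • X)
    ⟨⟨⟨hA.sq, hA.skew⟩, by simpa using hAn⟩, by simp [norm_smul, hXpos.ne']⟩
  rw [map_smul, hXA, norm_smul] at h1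
  simp only [Complex.norm_real, norm_inv, norm_norm] at h1
  rw [le_div_iff₀ hm, mul_comm]
  calc m * ‖X‖ ≤ ‖X‖⁻¹ * ‖A‖ * ‖X‖ := by gcongr
    _ = ‖A‖ := by field_simp
    _ ≤ _ := hAn

/-! ### Factorization with respect to part of the poles -/

lemma exists_regularValue_bound (p : ι → ℂ) (C : ℝ) : ∃ D : ℝ, 0 ≤ D ∧ ∀ X : ι → 𝔸,
    (∀ a, ‖X a‖ ≤ C) → ∀ a, ‖regularValue p 1 X a‖ ≤ D := by
  classical
  refine ⟨‖(1 : 𝔸)‖ + ∑ a, ∑ b, ‖(p a - p b)⁻¹‖ * max C 0, by positivity, fun X hX a => ?_⟩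
  refine (norm_add_le _ _).trans (add_le_add le_rfl ?_)
  refine (norm_sum_le _ _).trans ?_
  calc _ ≤ ∑ b ∈ Finset.univ.erase a, ‖(p a - p b)⁻¹‖ * max C 0 :=
        Finset.sum_le_sum fun b _ => by
          rw [norm_smul]
          gcongr
          exact (hX b).trans (le_max_left _ _)
    _ ≤ ∑ b, ‖(p a - p b)⁻¹‖ * max C 0 :=
        Finset.sum_le_sum_of_subset_of_nonneg (Finset.subset_univ _) fun _ _ _ => by positivity
    _ ≤ _ := Finset.single_le_sum (f := fun a => ∑ b, ‖(p a - p b)⁻¹‖ * max C 0)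
        (fun _ _ => by positivity) (Finset.mem_univ a)

/-- If the data `A'` arise from `A` by discarding the poles outside `I`, then `M M'⁻¹` has no poles
in `I`, and its residues at the discarded poles are bounded by the discarded data. -/
theorem exists_factorization (hstar : ∀ x : 𝔸, x * star x = 0 → x = 0)
    (hcomm : ∀ x y : 𝔸, x * y = 1 → y * x = 1) (p : ι → ℂ) (τ : ι → ι) (K : ℝ) :
    ∃ C : ℝ, 0 ≤ C ∧ ∀ (I : Set ι) (A A' : ι → 𝔸), IsSchwarzData p τ A → IsSchwarzData p τ A' →
      (∀ a, ‖A a‖ ≤ K) → (∀ a, τ a ∈ I → a ∈ I) → (∀ a ∈ I, A' a = A a) → (∀ a ∉ I, A' a = 0) →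
      ∀ M M' : ℂ → 𝔸, IsPoleSolution p A 1 M → IsPoleSolution p A' 1 M' →
      ∃ Y : ι → 𝔸, (∀ a ∈ I, Y a = 0) ∧ (∀ a, ‖Y a‖ ≤ C * ‖A a‖) ∧
        ∀ z ∉ Set.range p, M z = partialFractions p 1 Y z * M' z := by
  classical
  have : CompleteSpace 𝔸 := FiniteDimensional.complete ℂ 𝔸
  obtain ⟨C₁, hC₁, hb⟩ := exists_residue_bound hstar p τ K
  obtain ⟨D, hD, hreg⟩ := exists_regularValue_bound (𝔸 := 𝔸) p C₁
  refine ⟨D * D, by positivity,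
    fun I A A' hA hA' hAK hτ hin hout M M' hM hM' => ?_⟩
  obtain ⟨X, hX, hMX⟩ := hM.exists_partialFractions hA.injective hA.sq
  obtain ⟨X', hX', hMX'⟩ := hM'.exists_partialFractions hA.injective hA'.sq
  have hAK' : ∀ a, ‖A' a‖ ≤ K := fun a => by
    by_cases ha : a ∈ I
    · rw [hin a ha]; exact hAK a
    · rw [hout a ha, norm_zero]; exact (norm_nonneg _).trans (hAK a)
  have hXb := hreg X (hb A hA hAK X hX)
  have hXb' := hreg X' (hb A' hA' hAK' X' hX')
  -- outside `I` the factor `M'(z̄)†` of `M M'⁻¹` is analytic, and the residue of `M` is multiplied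
  -- by its value
  set Y : ι → 𝔸 := fun a => if a ∈ I then 0 else X a * star (regularValue p 1 X' (τ a)) with hY
  refine ⟨Y, fun a ha => by simp [hY, ha], fun a => ?_, fun z hz => ?_⟩
  · by_cases ha : a ∈ I
    · simp only [hY, ha, if_true, norm_zero]; positivity
    · simp only [hY, ha, if_false]
      calc _ ≤ ‖regularValue p 1 X a‖ * ‖A a‖ * ‖regularValue p 1 X' (τ a)‖ := by
            refine (norm_mul_le _ _).trans ?_
            rw [norm_star]
            gcongr
            conv_lhs => rw [hX a]
            exact norm_mul_le _ _
        _ ≤ D * ‖A a‖ * D := by gcongr <;> solve_by_elim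
        _ = _ := by ring
  · have hone : M' z * star (M' (star z)) = 1 := by
      simpa using hM'.mul_star_eq hA' hM' z hz
    have hW := eq_partialFractions hA.injective (X := Y) (B := 1)
      (differentiableOn_mul_star hA hM.differentiableOn hM'.differentiableOn)
      (by simpa using hM.tendsto.mul (hM'.tendsto.comp tendsto_star_cocompact).star)
      (fun a => ?_) z hz
    · rw [← hW, mul_assoc, hcomm _ _ hone, mul_one]
    · by_cases ha : a ∈ I
      · obtain ⟨L, hL⟩ := (hM.regular a).tendsto_mul_star (M' := M') (hA.sq a) (by
          rw [← hA.conj, ← hin a ha, ← hA'.skew]; exact hM'.regular (τ a))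
        simpa [hY, ha] using (tendsto_sub_nhdsNE (p a)).smul hL
      · have hτa : τ a ∉ I := fun h' => ha (hτ a h')
        obtain ⟨G, hG, -, hMG⟩ := partialFractions_principal hA.injective 1 X a
        obtain ⟨G', hG', hGa', hMG'⟩ := partialFractions_principal hA.injective 1 X' (τ a)
        have hX'0 : X' (τ a) = 0 := by rw [hX', hout _ hτa, mul_zero]
        have h1 : Tendsto (fun z => (z - p a) • M z) (𝓝[≠] (p a)) (𝓝 (X a)) := by
          refine tendsto_smul_of_principal (G := G) ?_ hG.continuousAt
          filter_upwards [eventually_notMem_range p (p a)] with w hw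
          rw [hMX w hw, hMG]
        have h2 : Tendsto (fun z => star (M' (star z))) (𝓝[≠] (p a))
            (𝓝 (star (regularValue p 1 X' (τ a)))) := by
          refine Tendsto.star ?_
          have h3 : Tendsto M' (𝓝[≠] (star (p a))) (𝓝 (regularValue p 1 X' (τ a))) := by
            rw [← hA.conj, ← hGa']
            refine (hG'.continuousAt.mono_left nhdsWithin_le_nhds).congr' ?_
            filter_upwards [eventually_notMem_range p (p (τ a))] with w hw
            rw [hMX' w hw, hMG', hX'0, smul_zero, zero_add]
          exact h3.comp (tendsto_star_nhdsNE (p a))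
        simpa [hY, ha, smul_mul_assoc] using h1.mul h2

end PoleProblem

open scoped Matrix.Norms.Frobenius

/-! ### Blaschke products -/

section Blaschke

variable {N : ℕ} {k : Fin N → ℂ}

lemma star_ne_of_im_pos (hk_im : ∀ j, 0 < (k j).im) (i j : Fin N) : k i ≠ star (k j) := by
  intro h
  have := congrArg Complex.im h
  rw [Complex.star_def, Complex.conj_im] at this
  linarith [hk_im i, hk_im j]

lemma blaschke_differentiableAt {Δ : Finset (Fin N)} {z : ℂ} (h : ∀ j ∈ Δ, z ≠ star (k j)) :
    DifferentiableAt ℂ (blaschke k Δ) z := by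
  have : DifferentiableAt ℂ (fun z => ∏ j ∈ Δ, (z - k j) / (z - star (k j))) z :=
    DifferentiableAt.fun_finsetProd fun j hj =>
      (differentiableAt_id.sub_const _).div (differentiableAt_id.sub_const _)
        (sub_ne_zero.2 (h j hj))
  exact this

lemma blaschke_ne_zero {Δ : Finset (Fin N)} {z : ℂ} (h : ∀ j ∈ Δ, z ≠ k j ∧ z ≠ star (k j)) :
    blaschke k Δ z ≠ 0 :=
  Finset.prod_ne_zero_iff.2 fun j hj =>
    div_ne_zero (sub_ne_zero.2 (h j hj).1) (sub_ne_zero.2 (h j hj).2)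

lemma star_blaschke_star (Δ : Finset (Fin N)) (z : ℂ) :
    star (blaschke k Δ (star z)) = (blaschke k Δ z)⁻¹ := by
  simp only [blaschke, Complex.star_def, map_prod, map_div₀, map_sub, Complex.conj_conj,
    ← Finset.prod_inv_distrib, inv_div]

lemma blaschke_tendsto (Δ : Finset (Fin N)) : Tendsto (blaschke k Δ) (cocompact ℂ) (𝓝 1) := by
  have h : Tendsto (fun z => ∏ j ∈ Δ, (z - k j) / (z - star (k j))) (cocompact ℂ)
      (𝓝 (∏ _j ∈ Δ, (1 : ℂ))) := by
    refine tendsto_finsetProd _ fun j _ => ?_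
    have := (tendsto_mul_sub_inv_cocompact (star (k j))).sub
      ((tendsto_sub_inv_cocompact (star (k j))).const_mul (k j))
    simp only [mul_zero, sub_zero] at this
    exact this.congr fun z => by rw [div_eq_mul_inv, sub_mul]
  rw [Finset.prod_const_one] at h
  exact h

lemma blaschke_union {D Δ : Finset (Fin N)} (h : Disjoint D Δ) (z : ℂ) :
    blaschke k (D ∪ Δ) z = blaschke k D z * blaschke k Δ z := Finset.prod_union h

/-- The cofactor of the zero `k j` in the Blaschke product. -/
noncomputable def blaschkeCofactor (k : Fin N → ℂ) (Δ : Finset (Fin N)) (j : Fin N) (z : ℂ) : ℂ :=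
  (z - star (k j))⁻¹ * blaschke k (Δ.erase j) z

lemma blaschke_eq_mul_cofactor {Δ : Finset (Fin N)} {j : Fin N} (hj : j ∈ Δ) (z : ℂ) :
    blaschke k Δ z = (z - k j) * blaschkeCofactor k Δ j z := by
  rw [blaschke, ← Finset.mul_prod_erase _ _ hj, blaschkeCofactor, blaschke, div_eq_mul_inv,
    mul_assoc]

lemma blaschkeCofactor_differentiableAt (hk_im : ∀ j, 0 < (k j).im) (Δ : Finset (Fin N))
    (j : Fin N) : DifferentiableAt ℂ (blaschkeCofactor k Δ j) (k j) :=
  (differentiableAt_sub_inv (star_ne_of_im_pos hk_im j j)).mul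
    (blaschke_differentiableAt fun i _ => star_ne_of_im_pos hk_im j i)

lemma blaschkeCofactor_ne_zero (hk : Function.Injective k) (hk_im : ∀ j, 0 < (k j).im)
    (Δ : Finset (Fin N)) (j : Fin N) : blaschkeCofactor k Δ j (k j) ≠ 0 :=
  mul_ne_zero (inv_ne_zero (sub_ne_zero.2 (star_ne_of_im_pos hk_im j j)))
    (blaschke_ne_zero fun _ hi => ⟨fun h => (Finset.mem_erase.1 hi).1 (hk h).symm,
      star_ne_of_im_pos hk_im _ _⟩)

lemma deriv_blaschke (hk_im : ∀ j, 0 < (k j).im) {Δ : Finset (Fin N)} {j : Fin N} (hj : j ∈ Δ) :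
    deriv (blaschke k Δ) (k j) = blaschkeCofactor k Δ j (k j) := by
  rw [funext (blaschke_eq_mul_cofactor (k := k) hj)]
  have h := ((hasDerivAt_id (k j)).sub_const (k j)).mul
    (blaschkeCofactor_differentiableAt hk_im Δ j).hasDerivAt
  simp only [sub_self, one_mul, zero_mul, add_zero, id_eq] at h
  exact h.deriv

lemma deriv_blaschke_union (hk_im : ∀ j, 0 < (k j).im) {D Δ : Finset (Fin N)}
    (h : Disjoint D Δ) {j : Fin N} (hj : j ∈ Δ) :
    deriv (blaschke k (D ∪ Δ)) (k j) = blaschke k D (k j) * deriv (blaschke k Δ) (k j) := by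
  have hjD : j ∉ D := fun h' => Finset.disjoint_left.1 h h' hj
  rw [deriv_blaschke hk_im (Finset.mem_union_right _ hj), deriv_blaschke hk_im hj,
    blaschkeCofactor, blaschkeCofactor, Finset.erase_union_distrib, Finset.erase_eq_of_notMem hjD,
    blaschke_union (h.mono_right (Finset.erase_subset _ _))]
  ring

end Blaschke

/-! ### Right multiplication by `a^{σ₄}` -/

section BlockMatrices

/-- The matrix `a^{σ₄} = diag(a, a, a⁻¹, a⁻¹)`. -/
noncomputable def sigmaPow (a : ℂ) : Mat4 := Matrix.fromBlocks (a • 1) 0 0 (a⁻¹ • 1)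

lemma sigmaPow_mul (a b : ℂ) : sigmaPow a * sigmaPow b = sigmaPow (a * b) := by
  simp [sigmaPow, Matrix.fromBlocks_multiply, smul_smul, mul_comm]

lemma sigmaPow_one : sigmaPow 1 = 1 := by
  simp [sigmaPow, Matrix.fromBlocks_one]

lemma star_sigmaPow (a : ℂ) : star (sigmaPow a) = sigmaPow (star a) := by
  simp [sigmaPow, Matrix.star_eq_conjTranspose, Matrix.fromBlocks_conjTranspose,
    Matrix.conjTranspose_smul]

lemma tendsto_fromBlocks {l : Filter ℂ} {a b c d : ℂ → Matrix (Fin 2) (Fin 2) ℂ}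
    {a' b' c' d' : Matrix (Fin 2) (Fin 2) ℂ} (ha : Tendsto a l (𝓝 a')) (hb : Tendsto b l (𝓝 b'))
    (hc : Tendsto c l (𝓝 c')) (hd : Tendsto d l (𝓝 d')) :
    Tendsto (fun z => Matrix.fromBlocks (a z) (b z) (c z) (d z)) l
      (𝓝 (Matrix.fromBlocks a' b' c' d')) := by
  have h : Continuous fun q : Matrix (Fin 2) (Fin 2) ℂ × Matrix (Fin 2) (Fin 2) ℂ ×
      Matrix (Fin 2) (Fin 2) ℂ × Matrix (Fin 2) (Fin 2) ℂ =>
      Matrix.fromBlocks q.1 q.2.1 q.2.2.1 q.2.2.2 :=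
    Continuous.matrix_fromBlocks continuous_fst (continuous_fst.comp continuous_snd)
      (continuous_fst.comp (continuous_snd.comp continuous_snd))
      (continuous_snd.comp (continuous_snd.comp continuous_snd))
  exact (h.tendsto (a', b', c', d')).comp
    (ha.prodMk_nhds (hb.prodMk_nhds (hc.prodMk_nhds hd)))

lemma tendsto_sigmaPow {l : Filter ℂ} {a : ℂ → ℂ} {a' : ℂ} (ha : Tendsto a l (𝓝 a'))
    (h : a' ≠ 0) : Tendsto (fun z => sigmaPow (a z)) l (𝓝 (sigmaPow a')) :=
  tendsto_fromBlocks (ha.smul_const _) tendsto_const_nhds tendsto_const_nhds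
    ((ha.inv₀ h).smul_const _)

lemma tendsto_sub_inv_mul {h : ℂ → ℂ} {p : ℂ} (hd : DifferentiableAt ℂ h p) (h0 : h p = 0) :
    Tendsto (fun z => (z - p)⁻¹ * h z) (𝓝[≠] p) (𝓝 (deriv h p)) := by
  refine (hasDerivAt_iff_tendsto_slope.1 hd.hasDerivAt).congr fun z => ?_
  rw [slope_def_module, h0, sub_zero, smul_eq_mul]

/-- Right multiplication by `a^{σ₄}` scales lower triangular residue data by `a(p)²` if `a(p) ≠ 0`. -/
lemma exists_tendsto_sigmaPow_of_ne_zero {a : ℂ → ℂ} {p : ℂ} (ha : DifferentiableAt ℂ a p)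
    (hap : a p ≠ 0) (c : Matrix (Fin 2) (Fin 2) ℂ) :
    ∃ L : Mat4, Tendsto (fun z => (1 + (z - p)⁻¹ • Matrix.fromBlocks 0 0 c 0) * sigmaPow (a z) *
      (1 - (z - p)⁻¹ • Matrix.fromBlocks 0 0 (a p ^ 2 • c) 0)) (𝓝[≠] p) (𝓝 L) := by
  have ha' : Tendsto a (𝓝[≠] p) (𝓝 (a p)) := ha.continuousAt.mono_left nhdsWithin_le_nhds
  have hslope := tendsto_sub_inv_mul (h := fun z => a z - a p ^ 2 * (a z)⁻¹)
    (ha.sub ((ha.inv hap).const_mul _)) (by field_simp; ring)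
  refine ⟨_, (tendsto_fromBlocks (ha'.smul_const 1) tendsto_const_nhds (hslope.smul_const c)
    ((ha'.inv₀ hap).smul_const 1) (b' := 0)).congr fun z => ?_⟩
  rw [sigmaPow, ← Matrix.fromBlocks_one, Matrix.fromBlocks_smul, Matrix.fromBlocks_smul,
    Matrix.fromBlocks_add, sub_eq_add_neg (Matrix.fromBlocks 1 0 0 1), Matrix.fromBlocks_neg,
    Matrix.fromBlocks_add,
    Matrix.fromBlocks_multiply, Matrix.fromBlocks_multiply]
  simp only [smul_zero, neg_zero, add_zero, zero_add, mul_zero, zero_mul, one_mul, mul_one,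
    smul_smul, Matrix.mul_smul, Matrix.smul_mul, ← neg_smul, ← add_smul]
  congr 2
  ring

/-- At a zero of `a`, right multiplication by `a^{σ₄}` turns lower triangular residue data into upper
triangular data. -/
lemma exists_tendsto_sigmaPow_of_zero {g : ℂ → ℂ} {p : ℂ} (hg : DifferentiableAt ℂ g p)
    (hgp : g p ≠ 0) {c d : Matrix (Fin 2) (Fin 2) ℂ} (hcd : c * d = (g p ^ 2)⁻¹ • 1) :
    ∃ L : Mat4, Tendsto (fun z => (1 + (z - p)⁻¹ • Matrix.fromBlocks 0 0 c 0) *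
      sigmaPow ((z - p) * g z) * (1 - (z - p)⁻¹ • Matrix.fromBlocks 0 d 0 0))
      (𝓝[≠] p) (𝓝 L) := by
  have hg' : Tendsto g (𝓝[≠] p) (𝓝 (g p)) := hg.continuousAt.mono_left nhdsWithin_le_nhds
  have hslope := tendsto_sub_inv_mul (h := fun z => (g z)⁻¹ - (g p ^ 2)⁻¹ * g z)
    ((hg.inv hgp).sub (hg.const_mul _)) (by field_simp; ring)
  refine ⟨_, (tendsto_fromBlocks (((tendsto_sub_nhdsNE p).mul hg').smul_const 1)
    (hg'.neg.smul_const d) (hg'.smul_const c) (hslope.smul_const 1)).congr' ?_⟩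
  filter_upwards [self_mem_nhdsWithin] with z hz
  have hz' : z - p ≠ 0 := sub_ne_zero.2 hz
  rw [sigmaPow, ← Matrix.fromBlocks_one, Matrix.fromBlocks_smul, Matrix.fromBlocks_smul,
    Matrix.fromBlocks_add, sub_eq_add_neg (Matrix.fromBlocks 1 0 0 1), Matrix.fromBlocks_neg,
    Matrix.fromBlocks_add,
    Matrix.fromBlocks_multiply, Matrix.fromBlocks_multiply]
  simp only [smul_zero, neg_zero, add_zero, zero_add, mul_zero, zero_mul, one_mul, mul_one,
    smul_smul, Matrix.mul_smul, Matrix.smul_mul, hcd, ← neg_smul, ← add_smul]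
  congr 2
  · field_simp
  · field_simp
  · rw [mul_inv]
    field_simp
    ring

/-- The counterpart of `exists_tendsto_sigmaPow_of_zero` for the inverse matrices. -/
lemma exists_tendsto_sigmaPow_inv_of_zero {g : ℂ → ℂ} {p : ℂ} (hg : DifferentiableAt ℂ g p)
    (hgp : g p ≠ 0) {c d : Matrix (Fin 2) (Fin 2) ℂ} (hdc : d * c = (g p ^ 2)⁻¹ • 1) :
    ∃ L : Mat4, Tendsto (fun z => (1 + (z - p)⁻¹ • Matrix.fromBlocks 0 d 0 0) *
      sigmaPow ((z - p) * g z)⁻¹ * (1 - (z - p)⁻¹ • Matrix.fromBlocks 0 0 c 0))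
      (𝓝[≠] p) (𝓝 L) := by
  have hg' : Tendsto g (𝓝[≠] p) (𝓝 (g p)) := hg.continuousAt.mono_left nhdsWithin_le_nhds
  have hslope := tendsto_sub_inv_mul (h := fun z => (g z)⁻¹ - (g p ^ 2)⁻¹ * g z)
    ((hg.inv hgp).sub (hg.const_mul _)) (by field_simp; ring)
  refine ⟨_, (tendsto_fromBlocks (hslope.smul_const 1) (hg'.smul_const d) (hg'.neg.smul_const c)
    (((tendsto_sub_nhdsNE p).mul hg').smul_const 1)).congr' ?_⟩
  filter_upwards [self_mem_nhdsWithin] with z hz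
  have hz' : z - p ≠ 0 := sub_ne_zero.2 hz
  rw [sigmaPow, ← Matrix.fromBlocks_one, Matrix.fromBlocks_smul, Matrix.fromBlocks_smul,
    Matrix.fromBlocks_add, sub_eq_add_neg (Matrix.fromBlocks 1 0 0 1), Matrix.fromBlocks_neg,
    Matrix.fromBlocks_add,
    Matrix.fromBlocks_multiply, Matrix.fromBlocks_multiply]
  simp only [smul_zero, neg_zero, add_zero, zero_add, mul_zero, zero_mul, one_mul, mul_one,
    smul_smul, Matrix.mul_smul, Matrix.smul_mul, hdc, ← neg_smul, ← add_smul,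
    inv_inv]
  congr 2
  · rw [mul_inv]
    field_simp
    ring
  · field_simp
  · field_simp

end BlockMatrices

/-! ### The residue data of the Riemann-Hilbert problem -/

section RHP

lemma frobNorm_eq_norm {m n : Type*} [Fintype m] [Fintype n] (A : Matrix m n ℂ) :
    frobNorm A = ‖A‖ := by
  simp only [Matrix.frobenius_norm_def, frobNorm, Real.sqrt_eq_rpow, Real.rpow_two]

open scoped ComplexOrder in
lemma mat4_eq_zero (A : Mat4) (h : A * star A = 0) : A = 0 :=
  Matrix.self_mul_conjTranspose_eq_zero.1 h

lemma mat4_differentiableOn_iff {M : ℂ → Mat4} {S : Set ℂ} :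
    DifferentiableOn ℂ M S ↔ ∀ a b, DifferentiableOn ℂ (fun z => M z a b) S := by
  constructor
  · intro h a b
    have he := (Matrix.entryLinearMap ℂ ℂ a b).toContinuousLinearMap.differentiable
    exact he.comp_differentiableOn h
  · intro h
    have : M = fun z => ∑ a, ∑ b, M z a b • Matrix.single a b (1 : ℂ) := by
      funext z
      conv_lhs => rw [Matrix.matrix_eq_sum_single (M z)]
      simp [Matrix.smul_single]
    rw [this]
    exact DifferentiableOn.fun_sum fun a _ => DifferentiableOn.fun_sum fun b _ =>
      (h a b).smul_const _

variable {N : ℕ} {k : Fin N → ℂ} {f : Fin N → Matrix (Fin 2) (Fin 2) ℂ} {J Δ : Finset (Fin N)}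
  {x t : ℝ}

/-- The poles `k_j` (left summand) and `k̄_j` (right summand). -/
def polePoint (k : Fin N → ℂ) : Fin N ⊕ Fin N → ℂ := Sum.elim k fun j => star (k j)

open Classical in
/-- The residue matrix at `k_j`, set to zero at the points that are not poles. -/
noncomputable def poleMatrix (k : Fin N → ℂ) (f : Fin N → Matrix (Fin 2) (Fin 2) ℂ)
    (J Δ : Finset (Fin N)) (x t : ℝ) (j : Fin N) : Mat4 :=
  if j ∈ J then residueMatrix k f Δ x t j else 0

/-- The residue matrices at all the points `k_j`, `k̄_j`. -/
noncomputable def poleData (k : Fin N → ℂ) (f : Fin N → Matrix (Fin 2) (Fin 2) ℂ)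
    (J Δ : Finset (Fin N)) (x t : ℝ) : Fin N ⊕ Fin N → Mat4 :=
  Sum.elim (poleMatrix k f J Δ x t) fun j => -star (poleMatrix k f J Δ x t j)

lemma range_polePoint (k : Fin N → ℂ) :
    Set.range (polePoint k) = poleSet k Finset.univ := by
  ext z
  simp only [polePoint, Set.mem_range, Sum.exists, Sum.elim_inl, Sum.elim_inr, poleSet,
    Finset.mem_univ, true_and, Set.mem_ofPred_eq, exists_or, eq_comm (a := z)]

lemma poleSet_subset_range (k : Fin N → ℂ) (J : Finset (Fin N)) :
    poleSet k J ⊆ Set.range (polePoint k) := by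
  rw [range_polePoint]
  rintro z ⟨j, -, h⟩
  exact ⟨j, Finset.mem_univ j, h⟩

lemma residueMatrix_sq (k : Fin N → ℂ) (f : Fin N → Matrix (Fin 2) (Fin 2) ℂ)
    (Δ : Finset (Fin N)) (x t : ℝ) (j : Fin N) :
    residueMatrix k f Δ x t j * residueMatrix k f Δ x t j = 0 := by
  unfold residueMatrix
  split_ifs <;> simp [Matrix.fromBlocks_multiply]

lemma isSchwarzData_poleData (hk : Function.Injective k) (hk_im : ∀ j, 0 < (k j).im)
    (f : Fin N → Matrix (Fin 2) (Fin 2) ℂ) (J Δ : Finset (Fin N)) (x t : ℝ) :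
    IsSchwarzData (polePoint k) Sum.swap (poleData k f J Δ x t) := by
  have hsq : ∀ j, poleMatrix k f J Δ x t j * poleMatrix k f J Δ x t j = 0 := fun j => by
    unfold poleMatrix
    split_ifs
    · exact residueMatrix_sq k f Δ x t j
    · simp
  refine ⟨?_, ?_, ?_, ?_, ?_⟩
  · exact hk.sumElim (star_injective.comp hk) fun i j => star_ne_of_im_pos hk_im i j
  · rintro (j | j)
    · exact (hk_im j).ne'
    · simpa [polePoint] using (hk_im j).ne'
  · rintro (j | j) <;> simp [polePoint]
  · rintro (j | j)
    · exact hsq j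
    · have := congrArg star (hsq j)
      simpa [poleData] using this
  · rintro (j | j) <;> simp [poleData]

lemma polePoint_notMem_poleSet (hk : Function.Injective k) (hk_im : ∀ j, 0 < (k j).im)
    {j : Fin N} (hj : j ∉ J) : k j ∉ poleSet k J ∧ star (k j) ∉ poleSet k J := by
  constructor
  · rintro ⟨i, hi, h | h⟩
    · exact hj (hk h ▸ hi)
    · exact star_ne_of_im_pos hk_im _ _ h
  · rintro ⟨i, hi, h | h⟩
    · exact star_ne_of_im_pos hk_im _ _ h.symm
    · exact hj (hk (star_injective h) ▸ hi)

lemma isOpen_compl_poleSet (k : Fin N → ℂ) (J : Finset (Fin N)) : IsOpen (poleSet k J)ᶜ :=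
  ((Set.finite_range (polePoint k)).subset (poleSet_subset_range k J)).isClosed.isOpen_compl

/-- The Riemann-Hilbert problem with poles in `J` is the problem on all the points `k_j`, `k̄_j`
with zero residue data off `J`, plus analyticity at the latter points. -/
lemma isRHSolution_iff (hk : Function.Injective k) (hk_im : ∀ j, 0 < (k j).im) {M : ℂ → Mat4} :
    IsRHSolution k f J Δ x t M ↔ DifferentiableOn ℂ M (poleSet k J)ᶜ ∧
      IsPoleSolution (polePoint k) (poleData k f J Δ x t) 1 M := by
  have hS := isSchwarzData_poleData hk hk_im f J Δ x t
  constructor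
  · intro h
    have hd := mat4_differentiableOn_iff.2 h.analytic
    have hcont : ∀ p ∉ poleSet k J, ∃ R : Mat4, Tendsto (fun z => (z - p) • M z) (𝓝[≠] p) (𝓝 R) ∧
        Tendsto (fun z => M z * (0 : Mat4)) (𝓝[≠] p) (𝓝 R) := fun p hp =>
      (regularAfter_zero_of_continuousAt ((hd p hp).differentiableAt
        ((isOpen_compl_poleSet k J).mem_nhds hp)).continuousAt).tendsto_residue (mul_zero _)
    refine ⟨hd, isPoleSolution_of_residues hS.injective hS.sq
      (hd.mono (Set.compl_subset_compl.2 (poleSet_subset_range k J))) h.normalized ?_⟩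
    rintro (j | j)
    · by_cases hj : j ∈ J
      · simp only [poleData, polePoint, poleMatrix, Sum.elim_inl, if_pos hj]
        exact h.residue j hj
      · simp only [poleData, polePoint, poleMatrix, Sum.elim_inl, if_neg hj]
        exact hcont _ (polePoint_notMem_poleSet hk hk_im hj).1
    · by_cases hj : j ∈ J
      · simp only [poleData, polePoint, poleMatrix, Sum.elim_inr, if_pos hj]
        exact h.residue_conj j hj
      · simp only [poleData, polePoint, poleMatrix, Sum.elim_inr, if_neg hj, star_zero, neg_zero]
        exact hcont _ (polePoint_notMem_poleSet hk hk_im hj).2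
  · rintro ⟨hd, h⟩
    refine ⟨mat4_differentiableOn_iff.1 hd, h.tendsto, fun j hj => ?_, fun j hj => ?_⟩
    · have := (h.regular (Sum.inl j)).tendsto_residue (hS.sq _)
      simp only [poleData, polePoint, poleMatrix, Sum.elim_inl, if_pos hj] at this
      exact this
    · have := (h.regular (Sum.inr j)).tendsto_residue (hS.sq _)
      simp only [poleData, polePoint, poleMatrix, Sum.elim_inr, if_pos hj] at this
      exact this

lemma IsRHSolution.unique (hk : Function.Injective k) (hk_im : ∀ j, 0 < (k j).im)
    {M M' : ℂ → Mat4} (h : IsRHSolution k f J Δ x t M) (h' : IsRHSolution k f J Δ x t M') :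
    Set.EqOn M' M (poleSet k J)ᶜ := by
  obtain ⟨hd, hM⟩ := (isRHSolution_iff hk hk_im).1 h
  obtain ⟨hd', hM'⟩ := (isRHSolution_iff hk hk_im).1 h'
  have hu := hM'.unique mat4_eq_zero (isSchwarzData_poleData hk hk_im f J Δ x t) hM
  intro z hz
  have hz' := (isOpen_compl_poleSet k J).mem_nhds hz
  have h1 := (((hd' z hz).differentiableAt hz').continuousAt).tendsto.mono_left
    (nhdsWithin_le_nhds (s := {z}ᶜ))
  have h2 := (((hd z hz).differentiableAt hz').continuousAt).tendsto.mono_left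
    (nhdsWithin_le_nhds (s := {z}ᶜ))
  refine tendsto_nhds_unique (h1.congr' ?_) h2
  filter_upwards [eventually_notMem_range (polePoint k) z] with w hw using hu w hw

/-! ### Changing the triangularity set -/

lemma sigmaPow_eq (a : ℂ) : sigmaPow a =
    a • (Matrix.fromBlocks 1 0 0 0 : Mat4) + a⁻¹ • (Matrix.fromBlocks 0 0 0 1 : Mat4) := by
  simp [sigmaPow, Matrix.fromBlocks_smul, Matrix.fromBlocks_add]

lemma poleMatrix_of_notMem {j : Fin N} (hj : j ∉ Δ) :
    ∃ c, poleMatrix k f J ∅ x t j = Matrix.fromBlocks 0 0 c 0 ∧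
      poleMatrix k f J Δ x t j = Matrix.fromBlocks 0 0 (blaschke k Δ (k j) ^ 2 • c) 0 := by
  by_cases hJ : j ∈ J
  · refine ⟨Complex.exp (2 * Complex.I * phase x t (k j)) • f j, ?_, ?_⟩
    · simp [poleMatrix, hJ, residueMatrix, blaschke]
    · simp [poleMatrix, hJ, residueMatrix, hj, smul_smul]
  · exact ⟨0, by simp [poleMatrix, hJ], by simp [poleMatrix, hJ]⟩

lemma poleMatrix_of_mem (hk_im : ∀ j, 0 < (k j).im) {j : Fin N} (hf : (f j).det ≠ 0)
    (hJ : j ∈ J) (hj : j ∈ Δ) :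
    ∃ c d, poleMatrix k f J ∅ x t j = Matrix.fromBlocks 0 0 c 0 ∧
      poleMatrix k f J Δ x t j = Matrix.fromBlocks 0 d 0 0 ∧
      c * d = (blaschkeCofactor k Δ j (k j) ^ 2)⁻¹ • 1 ∧
      d * c = (blaschkeCofactor k Δ j (k j) ^ 2)⁻¹ • 1 := by
  have hexp : Complex.exp (2 * Complex.I * phase x t (k j)) *
      Complex.exp (-2 * Complex.I * phase x t (k j)) = 1 := by
    rw [← Complex.exp_add]
    simp
  refine ⟨Complex.exp (2 * Complex.I * phase x t (k j)) • f j,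
    ((blaschkeCofactor k Δ j (k j) ^ 2)⁻¹ * Complex.exp (-2 * Complex.I * phase x t (k j))) •
      (f j)⁻¹, ?_, ?_, ?_, ?_⟩
  · simp [poleMatrix, hJ, residueMatrix, blaschke]
  · rw [poleMatrix, if_pos hJ, residueMatrix, if_pos hj, deriv_blaschke hk_im hj]
  · rw [Matrix.smul_mul, Matrix.mul_smul, smul_smul, Matrix.mul_nonsing_inv _ hf.isUnit,
      mul_left_comm, hexp, mul_one]
  · rw [Matrix.smul_mul, Matrix.mul_smul, smul_smul, Matrix.nonsing_inv_mul _ hf.isUnit,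
      mul_assoc, mul_comm (Complex.exp (-2 * _ * _)), hexp, mul_one]

/-- Schwarz reflection carries the residue condition at `p` to that at `p̄`. -/
lemma exists_tendsto_sigmaPow_star {a : ℂ → ℂ} {p : ℂ} {A A' : Mat4}
    (ha : ∀ w, star (a (star w)) = (a w)⁻¹)
    (h : ∃ L : Mat4, Tendsto (fun w => (1 + (w - p)⁻¹ • A') * sigmaPow (a w)⁻¹ *
      (1 - (w - p)⁻¹ • A)) (𝓝[≠] p) (𝓝 L)) :
    ∃ L : Mat4, Tendsto (fun z => (1 + (z - star p)⁻¹ • (-star A)) * sigmaPow (a z) *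
      (1 - (z - star p)⁻¹ • (-star A'))) (𝓝[≠] (star p)) (𝓝 L) := by
  obtain ⟨L, hL⟩ := h
  have hs := tendsto_star_nhdsNE (star p)
  rw [star_star] at hs
  refine ⟨star L, (hL.comp hs).star.congr fun z => ?_⟩
  have h1 : star ((a (star z))⁻¹) = a z := by
    rw [← ha, star_star, star_star]
  simp only [Function.comp_apply, star_mul, star_sub, star_add, star_one, star_smul, star_sigmaPow,
    h1, star_inv₀, star_star, smul_neg, sub_neg_eq_add, ← sub_eq_add_neg, mul_assoc]

lemma notMem_poleSet {z : ℂ} (hΔ : Δ ⊆ J) (hz : z ∉ poleSet k J) :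
    ∀ j ∈ Δ, z ≠ k j ∧ z ≠ star (k j) := fun j hj =>
  ⟨fun h => hz ⟨j, hΔ hj, Or.inl h⟩, fun h => hz ⟨j, hΔ hj, Or.inr h⟩⟩

/-- The basic solution, multiplied by `a_Δ^{σ₄}`, solves the problem with triangularity set `Δ`. -/
lemma IsRHSolution.mul_sigmaPow (hk : Function.Injective k) (hk_im : ∀ j, 0 < (k j).im)
    (hf : ∀ j ∈ J, (f j).det ≠ 0) (hΔ : Δ ⊆ J) {M : ℂ → Mat4} (h : IsRHSolution k f J ∅ x t M) :
    IsRHSolution k f J Δ x t fun z => M z * sigmaPow (blaschke k Δ z) := by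
  have hS := isSchwarzData_poleData hk hk_im f J ∅ x t
  obtain ⟨hd, hM⟩ := (isRHSolution_iff hk hk_im).1 h
  have hd' : DifferentiableOn ℂ (fun z => M z * sigmaPow (blaschke k Δ z)) (poleSet k J)ᶜ := by
    refine hd.mul fun z hz => ?_
    have hz' := notMem_poleSet hΔ hz
    have hb := blaschke_differentiableAt fun j hj => (hz' j hj).2
    simp only [sigmaPow_eq]
    exact ((hb.smul_const _).add
      ((hb.inv (blaschke_ne_zero hz')).smul_const _)).differentiableWithinAt
  have hb : ∀ j, DifferentiableAt ℂ (blaschke k Δ) (k j) := fun j =>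
    blaschke_differentiableAt fun i _ => star_ne_of_im_pos hk_im j i
  have hb0 : ∀ j ∉ Δ, blaschke k Δ (k j) ≠ 0 := fun j hj =>
    blaschke_ne_zero fun i hi => ⟨fun h => hj (hk h ▸ hi), star_ne_of_im_pos hk_im j i⟩
  refine (isRHSolution_iff hk hk_im).2 ⟨hd',
    hd'.mono (Set.compl_subset_compl.2 (poleSet_subset_range k J)), ?_, fun a => ?_⟩
  · have := hM.tendsto.mul (tendsto_sigmaPow (blaschke_tendsto (k := k) Δ) one_ne_zero)
    rwa [sigmaPow_one, mul_one] at this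
  · refine (hM.regular a).mul_right (hS.sq a) ?_
    rcases a with j | j
    · simp only [polePoint, poleData, Sum.elim_inl]
      by_cases hj : j ∈ Δ
      · obtain ⟨c, d, hc, hd, hcd, -⟩ :=
          poleMatrix_of_mem (x := x) (t := t) hk_im (hf j (hΔ hj)) (hΔ hj) hj
        rw [hc, hd]
        simp only [blaschke_eq_mul_cofactor hj]
        exact exists_tendsto_sigmaPow_of_zero (blaschkeCofactor_differentiableAt hk_im Δ j)
          (blaschkeCofactor_ne_zero hk hk_im Δ j) hcd
      · obtain ⟨c, hc, hd⟩ := poleMatrix_of_notMem (k := k) (f := f) (J := J) (x := x) (t := t) hj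
        rw [hc, hd]
        exact exists_tendsto_sigmaPow_of_ne_zero (hb j) (hb0 j hj) c
    · simp only [polePoint, poleData, Sum.elim_inr]
      refine exists_tendsto_sigmaPow_star (star_blaschke_star Δ) ?_
      by_cases hj : j ∈ Δ
      · obtain ⟨c, d, hc, hd, -, hdc⟩ :=
          poleMatrix_of_mem (x := x) (t := t) hk_im (hf j (hΔ hj)) (hΔ hj) hj
        rw [hc, hd]
        simp only [blaschke_eq_mul_cofactor hj]
        exact exists_tendsto_sigmaPow_inv_of_zero (blaschkeCofactor_differentiableAt hk_im Δ j)
          (blaschkeCofactor_ne_zero hk hk_im Δ j) hdc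
      · obtain ⟨c, hc, hd⟩ := poleMatrix_of_notMem (k := k) (f := f) (J := J) (x := x) (t := t) hj
        have h1 := exists_tendsto_sigmaPow_of_ne_zero ((hb j).inv (hb0 j hj))
          (inv_ne_zero (hb0 j hj)) (blaschke k Δ (k j) ^ 2 • c)
        rw [hc, hd]
        rwa [smul_smul, Pi.inv_apply, ← mul_pow, inv_mul_cancel₀ (hb0 j hj), one_pow,
          one_smul] at h1

/-! ### Existence, uniqueness and the potential -/

lemma tendsto_potential_partialFractions {ι : Type*} [Fintype ι] (p : ι → ℂ) (X : ι → Mat4) :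
    HasPotential (partialFractions p 1 X) ((2 * Complex.I) • ∑ a, (X a).toBlocks₁₂) := by
  have h : Tendsto (fun z : ℂ => (2 * Complex.I) • ∑ a, (z * (z - p a)⁻¹) • (X a).toBlocks₁₂)
      (cocompact ℂ) (𝓝 ((2 * Complex.I) • ∑ a, (1 : ℂ) • (X a).toBlocks₁₂)) :=
    (tendsto_finsetSum _ fun a _ =>
      (tendsto_mul_sub_inv_cocompact (p a)).smul_const ((X a).toBlocks₁₂)).const_smul _
  simp only [one_smul] at h
  refine h.congr fun z => ?_
  ext i j
  simp [partialFractions, Matrix.toBlocks₁₂, Matrix.sum_apply, Finset.mul_sum, mul_assoc]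

lemma toBlocks₁₂_mul_sigmaPow (M : Mat4) (a : ℂ) :
    (M * sigmaPow a).toBlocks₁₂ = a⁻¹ • M.toBlocks₁₂ := by
  conv_lhs => rw [← Matrix.fromBlocks_toBlocks M]
  simp [sigmaPow, Matrix.fromBlocks_multiply]

lemma HasPotential.mul_sigmaPow {M : ℂ → Mat4} {q : Matrix (Fin 2) (Fin 2) ℂ}
    (h : HasPotential M q) (Δ : Finset (Fin N)) :
    HasPotential (fun z => M z * sigmaPow (blaschke k Δ z)) q := by
  have h1 := ((blaschke_tendsto (k := k) Δ).inv₀ one_ne_zero).smul h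
  rw [inv_one, one_smul] at h1
  refine h1.congr fun z => ?_
  simp only [toBlocks₁₂_mul_sigmaPow]
  rw [smul_comm]

lemma HasPotential.unique {M M' : ℂ → Mat4} {q q' : Matrix (Fin 2) (Fin 2) ℂ}
    (h : HasPotential M q) (h' : HasPotential M' q')
    (hM : ∀ᶠ z in cocompact ℂ, M z = M' z) : q = q' := by
  refine tendsto_nhds_unique h (Tendsto.congr' ?_ h')
  filter_upwards [hM] with z hz
  rw [hz]

lemma exists_isRHSolution_empty (hk : Function.Injective k) (hk_im : ∀ j, 0 < (k j).im)
    (f : Fin N → Matrix (Fin 2) (Fin 2) ℂ) (J : Finset (Fin N)) (x t : ℝ) :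
    ∃ M q, IsRHSolution k f J ∅ x t M ∧ HasPotential M q := by
  obtain ⟨X, hX, hM⟩ := exists_isPoleSolution mat4_eq_zero
    (isSchwarzData_poleData hk hk_im f J ∅ x t) 1
  refine ⟨_, _, (isRHSolution_iff hk hk_im).2 ⟨fun z hz => ?_, hM⟩,
    tendsto_potential_partialFractions _ _⟩
  refine (DifferentiableAt.const_add _
    (DifferentiableAt.fun_sum fun a _ => ?_)).differentiableWithinAt
  by_cases hza : z = polePoint k a
  · -- the residue vanishes at a point that is not a pole
    have hXa : X a = 0 := by
      rw [hX a]
      rcases a with j | j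
      · have hj : j ∉ J := fun hj => hz ⟨j, hj, Or.inl hza⟩
        simp [poleData, poleMatrix, hj]
      · have hj : j ∉ J := fun hj => hz ⟨j, hj, Or.inr hza⟩
        simp [poleData, poleMatrix, hj]
    simp [hXa]
  · exact (differentiableAt_sub_inv hza).smul_const _

theorem exists_unique_isRHSolution (hk : Function.Injective k) (hk_im : ∀ j, 0 < (k j).im)
    {J : Finset (Fin N)} (hf : ∀ j ∈ J, (f j).det ≠ 0) (x t : ℝ) :
    ∃ q : Matrix (Fin 2) (Fin 2) ℂ, ∀ Δ ⊆ J,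
      ∃ M : ℂ → Mat4, IsRHSolution k f J Δ x t M ∧ HasPotential M q ∧
        ∀ M' : ℂ → Mat4, IsRHSolution k f J Δ x t M' → Set.EqOn M' M (poleSet k J)ᶜ := by
  obtain ⟨M, q, hM, hq⟩ := exists_isRHSolution_empty hk hk_im f J x t
  refine ⟨q, fun Δ hΔ => ?_⟩
  have h := hM.mul_sigmaPow hk hk_im hf hΔ
  exact ⟨_, h, hq.mul_sigmaPow Δ, fun M' hM' => h.unique hk hk_im hM'⟩

/-- The potential of the basic solution is that of the problem with any triangularity set. -/
lemma IsSolitonSolution.hasPotential (hk : Function.Injective k) (hk_im : ∀ j, 0 < (k j).im)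
    (hf : ∀ j ∈ J, (f j).det ≠ 0) (hΔ : Δ ⊆ J) {q : Matrix (Fin 2) (Fin 2) ℂ}
    (h : IsSolitonSolution k f J Δ x t q) {M : ℂ → Mat4} (hM : IsRHSolution k f J ∅ x t M) :
    HasPotential M q := by
  obtain ⟨M', hM', hq'⟩ := h
  obtain ⟨q₀, h₀⟩ := exists_unique_isRHSolution hk hk_im hf x t
  have hev : ∀ᶠ z in cocompact ℂ, z ∈ (poleSet k J)ᶜ := by
    filter_upwards [eventually_notMem_range_cocompact (polePoint k)] with z hz
    exact fun h => hz (poleSet_subset_range k J h)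
  obtain ⟨M₁, -, hq₁, hu₁⟩ := h₀ Δ hΔ
  obtain ⟨M₂, -, hq₂, hu₂⟩ := h₀ ∅ (Finset.empty_subset _)
  have hqq : q = q₀ := hq'.unique hq₁ (hev.mono fun z hz => hu₁ M' hM' hz)
  rw [hqq]
  refine Tendsto.congr' ?_ hq₂
  filter_upwards [hev] with z hz
  rw [hu₂ M hM hz]

end RHP

/-! ### Decay of the residue matrices -/

section Asymptotics

lemma norm_toBlocks₁₂_le (A : Mat4) : ‖A.toBlocks₁₂‖ ≤ ‖A‖ := by
  rw [← frobNorm_eq_norm, ← frobNorm_eq_norm]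
  refine Real.sqrt_le_sqrt ?_
  simp only [Fintype.sum_sum_type, Matrix.toBlocks₁₂, Matrix.of_apply, Finset.sum_add_distrib]
  have h1 : 0 ≤ ∑ i : Fin 2, ∑ j : Fin 2, ‖A (Sum.inl i) (Sum.inl j)‖ ^ 2 := by positivity
  have h2 : 0 ≤ ∑ i : Fin 2, ∑ j : Fin 2, ‖A (Sum.inr i) (Sum.inl j)‖ ^ 2 := by positivity
  have h3 : 0 ≤ ∑ i : Fin 2, ∑ j : Fin 2, ‖A (Sum.inr i) (Sum.inr j)‖ ^ 2 := by positivity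
  linarith

lemma norm_fromBlocks_upper (B : Matrix (Fin 2) (Fin 2) ℂ) :
    ‖(Matrix.fromBlocks 0 B 0 0 : Mat4)‖ = ‖B‖ := by
  rw [← frobNorm_eq_norm, ← frobNorm_eq_norm]
  simp [frobNorm, Fintype.sum_sum_type]

lemma norm_fromBlocks_lower (B : Matrix (Fin 2) (Fin 2) ℂ) :
    ‖(Matrix.fromBlocks 0 0 B 0 : Mat4)‖ = ‖B‖ := by
  rw [← frobNorm_eq_norm, ← frobNorm_eq_norm]
  simp [frobNorm, Fintype.sum_sum_type]

lemma phase_im (x t : ℝ) (z : ℂ) : (phase x t z).im = z.im * (x + 4 * t * z.re) := by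
  simp [phase, pow_two]
  ring

lemma norm_exp_phase (x t : ℝ) (z : ℂ) :
    ‖Complex.exp (2 * Complex.I * phase x t z)‖ = Real.exp (-2 * z.im * (x + 4 * t * z.re)) := by
  rw [Complex.norm_exp]
  simp [mul_assoc, phase_im]

lemma norm_exp_neg_phase (x t : ℝ) (z : ℂ) :
    ‖Complex.exp (-2 * Complex.I * phase x t z)‖ = Real.exp (2 * z.im * (x + 4 * t * z.re)) := by
  rw [Complex.norm_exp]
  simp [mul_assoc, phase_im]

variable {N : ℕ} {k : Fin N → ℂ}

lemma lt_neg_div_iff {x t r : ℝ} (ht : 0 < t) : r < -x / (4 * t) ↔ x + 4 * t * r < 0 := by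
  rw [lt_div_iff₀ (by positivity)]
  constructor <;> intro h <;> linarith

/-- With the triangularity set `Δ_{k₀}⁻` no exponential in the residue matrices grows. -/
lemma exists_norm_residueMatrix_le (k : Fin N → ℂ) (K : ℝ) :
    ∃ C : ℝ, 0 ≤ C ∧ ∀ f : Fin N → Matrix (Fin 2) (Fin 2) ℂ,
      (∀ j, frobNorm (f j) ≤ K ∧ frobNorm ((f j)⁻¹) ≤ K) → ∀ x t : ℝ, 0 < t → ∀ j,
      ‖residueMatrix k f (leftOf k (-x / (4 * t))) x t j‖ ≤
        C * Real.exp (-2 * (k j).im * |x + 4 * t * (k j).re|) := by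
  classical
  set b : Finset (Fin N) → Fin N → ℝ := fun Δ j =>
    ‖blaschke k Δ (k j) ^ 2‖ + ‖(deriv (blaschke k Δ) (k j) ^ 2)⁻¹‖ with hb
  have hb0 : ∀ Δ j, 0 ≤ b Δ j := fun Δ j => by positivity
  set S : ℝ := ∑ Δ, ∑ j, b Δ j with hS
  have hle : ∀ Δ j, b Δ j ≤ S := fun Δ j =>
    (Finset.single_le_sum (f := b Δ) (fun i _ => hb0 Δ i) (Finset.mem_univ j)).trans
      (Finset.single_le_sum (f := fun Δ => ∑ j, b Δ j)
        (fun Δ _ => Finset.sum_nonneg fun i _ => hb0 Δ i) (Finset.mem_univ Δ))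
  have hS0 : 0 ≤ S := Finset.sum_nonneg fun Δ _ => Finset.sum_nonneg fun i _ => hb0 Δ i
  refine ⟨S * max K 0, by positivity, fun f hf x t ht j => ?_⟩
  set Δ := leftOf k (-x / (4 * t)) with hΔ
  have hmem : j ∈ Δ ↔ x + 4 * t * (k j).re < 0 := by
    simp [hΔ, leftOf, lt_neg_div_iff ht]
  have hf1 : ‖f j‖ ≤ max K 0 := by
    rw [← frobNorm_eq_norm]; exact (hf j).1.trans (le_max_left _ _)
  have hf2 : ‖(f j)⁻¹‖ ≤ max K 0 := by
    rw [← frobNorm_eq_norm]; exact (hf j).2.trans (le_max_left _ _)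
  have h1 : ‖blaschke k Δ (k j) ^ 2‖ ≤ S :=
    (le_add_of_nonneg_right (norm_nonneg _)).trans (hle Δ j)
  have h2 : ‖(deriv (blaschke k Δ) (k j) ^ 2)⁻¹‖ ≤ S :=
    (le_add_of_nonneg_left (norm_nonneg _)).trans (hle Δ j)
  by_cases hj : j ∈ Δ
  · have hneg := hmem.1 hj
    rw [residueMatrix, if_pos hj, norm_fromBlocks_upper, norm_smul, norm_mul, norm_exp_neg_phase,
      abs_of_neg hneg, mul_right_comm,
      show 2 * (k j).im * (x + 4 * t * (k j).re) = -2 * (k j).im * -(x + 4 * t * (k j).re) by ring]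
    gcongr
  · have hnn : 0 ≤ x + 4 * t * (k j).re := not_lt.1 fun h => hj (hmem.2 h)
    rw [residueMatrix, if_neg hj, norm_fromBlocks_lower, norm_smul, norm_mul, norm_exp_phase,
      abs_of_nonneg hnn, mul_right_comm]
    gcongr

/-! ### The geometry of the cone -/

variable {x₁ x₂ v₁ v₂ : ℝ}

/-- In the cone, `k₀ = -x / (4 t)` is within `O(1 / t)` of the interval. -/
lemma exists_of_mem_cone {x t : ℝ} (h : (x, t) ∈ cone x₁ x₂ v₁ v₂) :
    ∃ x₀ v : ℝ, |x₀| ≤ max |x₁| |x₂| ∧ v₁ ≤ v ∧ v ≤ v₂ ∧ ∀ r : ℝ,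
      x + 4 * t * r = x₀ + 4 * t * (r + v / 4) ∧
        Metric.infDist r (velocityInterval v₁ v₂) ≤ |r + v / 4| := by
  obtain ⟨x₀, hx₀, v, hv, hx⟩ := h
  refine ⟨x₀, v, ?_, hv.1, hv.2, fun r => ⟨?_, ?_⟩⟩
  · exact abs_le_max_abs_abs hx₀.1 hx₀.2
  · simp only at hx
    rw [hx]
    ring
  · have hmem : -v / 4 ∈ velocityInterval v₁ v₂ :=
      ⟨by linarith [hv.2], by linarith [hv.1]⟩
    refine (Metric.infDist_le_dist_of_mem hmem).trans_eq ?_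
    rw [Real.dist_eq]
    congr 1
    ring

lemma le_abs_of_mem_cone {x t : ℝ} (ht : 0 ≤ t) (h : (x, t) ∈ cone x₁ x₂ v₁ v₂) (r : ℝ) :
    4 * t * Metric.infDist r (velocityInterval v₁ v₂) - max |x₁| |x₂| ≤ |x + 4 * t * r| := by
  obtain ⟨x₀, v, hx₀, -, -, hr⟩ := exists_of_mem_cone h
  obtain ⟨h1, h2⟩ := hr r
  rw [h1]
  have h3 : |4 * t * (r + v / 4)| = 4 * t * |r + v / 4| := by
    rw [abs_mul, abs_of_nonneg (by positivity : 0 ≤ 4 * t)]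
  have h4 := abs_sub_abs_le_abs_add (4 * t * (r + v / 4)) x₀
  rw [add_comm _ x₀, h3] at h4
  have h5 : 4 * t * Metric.infDist r (velocityInterval v₁ v₂) ≤ 4 * t * |r + v / 4| := by gcongr
  linarith

/-- Once `t` is large, `k₀` and the interval lie on the same side of each excluded eigenvalue. -/
lemma exists_time_leftOf (k : Fin N → ℂ) (x₁ x₂ : ℝ) (hv : v₁ ≤ v₂) :
    ∃ T : ℝ, 0 < T ∧ ∀ x t : ℝ, T ≤ t → (x, t) ∈ cone x₁ x₂ v₁ v₂ → ∀ j ∈ outside k v₁ v₂,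
      ((k j).re < -x / (4 * t) ↔ (k j).re < -v₂ / 4) := by
  have hgap : ∀ j ∈ outside k v₁ v₂,
      0 < Metric.infDist (k j).re (velocityInterval v₁ v₂) := fun j hj => by
    have hj' : (k j).re ∉ velocityInterval v₁ v₂ := by simpa [outside] using hj
    exact (isClosed_Icc.notMem_iff_infDist_pos
      (Set.nonempty_Icc.2 (by linarith) : (velocityInterval v₁ v₂).Nonempty)).1 hj'
  have hev : ∀ᶠ t : ℝ in atTop, 0 < t ∧ ∀ j ∈ outside k v₁ v₂,
      max |x₁| |x₂| < t * (4 * Metric.infDist (k j).re (velocityInterval v₁ v₂)) := by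
    refine (eventually_gt_atTop 0).and ((Finset.eventually_all _).2 fun j hj => ?_)
    exact (tendsto_id.atTop_mul_const (mul_pos four_pos (hgap j hj))).eventually_gt_atTop _
  obtain ⟨T, hT⟩ := eventually_atTop.1 hev
  refine ⟨T, (hT T le_rfl).1, fun x t ht hxt j hj => ?_⟩
  obtain ⟨ht0, hlt⟩ := hT t ht
  have hX := hlt j hj
  obtain ⟨x₀, v, hx₀, hv1, hv2, hr⟩ := exists_of_mem_cone hxt
  obtain ⟨h1, h2⟩ := hr (k j).re
  rw [lt_neg_div_iff ht0, h1]
  have hx₀' := abs_le.1 hx₀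
  have hmul : t * (4 * Metric.infDist (k j).re (velocityInterval v₁ v₂)) ≤
      t * (4 * |(k j).re + v / 4|) := by gcongr
  have hj' : (k j).re ∉ velocityInterval v₁ v₂ := by simpa [outside] using hj
  by_cases hlt' : (k j).re < -v₂ / 4
  · rw [abs_of_neg (by linarith)] at hmul
    exact ⟨fun _ => hlt', fun _ => by linarith⟩
  · have hgt : -v₁ / 4 < (k j).re := not_le.1 fun h => hj' ⟨not_lt.1 hlt', h⟩
    rw [abs_of_pos (by linarith)] at hmul
    exact ⟨fun h => by linarith, fun h => absurd h hlt'⟩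

lemma disjoint_leftOf_inside (k : Fin N → ℂ) (v₁ v₂ : ℝ) :
    Disjoint (leftOf k (-v₂ / 4)) (inside k v₁ v₂) := by
  refine Finset.disjoint_left.2 fun j hj hj' => ?_
  simp only [leftOf, inside, velocityInterval, Finset.mem_filter, Finset.mem_univ, true_and,
    Set.mem_Icc] at hj hj'
  linarith [hj'.1]

lemma leftOf_eq_union {c : ℝ} (h : ∀ j ∈ outside k v₁ v₂, (k j).re < c ↔ (k j).re < -v₂ / 4) :
    (leftOf k c) = leftOf k (-v₂ / 4) ∪ (leftOf k c ∩ inside k v₁ v₂) := by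
  ext j
  by_cases hj : j ∈ inside k v₁ v₂
  · have := fun h' => Finset.disjoint_left.1 (disjoint_leftOf_inside k v₁ v₂) h' hj
    simpa [hj] using fun h' => (this h').elim
  · have hj' : j ∈ outside k v₁ v₂ := by simpa [inside, outside] using hj
    simpa [hj, leftOf] using h j hj'

/-! ### Localization of the Riemann-Hilbert problem -/

/-- For the eigenvalues that are kept, the full residue matrices are the reduced ones: the factor
`a_{Δ_I⁻}` of the Blaschke product is absorbed into the modulated residue constants. -/
lemma poleMatrix_modulated (hk_im : ∀ j, 0 < (k j).im) {f : Fin N → Matrix (Fin 2) (Fin 2) ℂ}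
    (hf : ∀ j, (f j).det ≠ 0) {Δ' : Finset (Fin N)} (hk : Function.Injective k)
    (hΔ' : Δ' ⊆ inside k v₁ v₂) (x t : ℝ) {j : Fin N} (hj : j ∈ inside k v₁ v₂) :
    poleMatrix k (modulated k f v₂) (inside k v₁ v₂) Δ' x t j =
      poleMatrix k f Finset.univ (leftOf k (-v₂ / 4) ∪ Δ') x t j := by
  have hdis := disjoint_leftOf_inside k v₁ v₂
  have hjD : j ∉ leftOf k (-v₂ / 4) := fun h => Finset.disjoint_left.1 hdis h hj
  have hne : blaschke k (leftOf k (-v₂ / 4)) (k j) ≠ 0 :=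
    blaschke_ne_zero fun i hi => ⟨fun h => hjD (hk h ▸ hi), star_ne_of_im_pos hk_im j i⟩
  rw [poleMatrix, if_pos hj, poleMatrix, if_pos (Finset.mem_univ j), residueMatrix, residueMatrix]
  by_cases hjΔ : j ∈ Δ'
  · rw [if_pos hjΔ, if_pos (Finset.mem_union_right _ hjΔ),
      deriv_blaschke_union hk_im (hdis.mono_right hΔ') hjΔ, modulated]
    have hinv : (blaschke k (leftOf k (-v₂ / 4)) (k j) ^ 2 • f j)⁻¹ =
        (blaschke k (leftOf k (-v₂ / 4)) (k j) ^ 2)⁻¹ • (f j)⁻¹ := by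
      refine Matrix.inv_eq_right_inv ?_
      rw [Matrix.smul_mul, Matrix.mul_smul, smul_smul, Matrix.mul_nonsing_inv _ (hf j).isUnit,
        mul_inv_cancel₀ (pow_ne_zero 2 hne), one_smul]
    rw [hinv, smul_smul, mul_pow, mul_inv]
    congr 2
    ring
  · have hjU : j ∉ leftOf k (-v₂ / 4) ∪ Δ' := by simp [hjD, hjΔ]
    rw [if_neg hjΔ, if_neg hjU, modulated, smul_smul, blaschke_union (hdis.mono_right hΔ'), mul_pow]
    congr 2
    ring

/-- Only the eigenvalues in `Z(I)` keep an invertible residue constant: `a_{Δ_I⁻}` vanishes at those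
to the left of `I`. -/
lemma modulated_det_ne_zero (hk_im : ∀ j, 0 < (k j).im)
    {f : Fin N → Matrix (Fin 2) (Fin 2) ℂ} (hf : ∀ j, (f j).det ≠ 0)
    (hk : Function.Injective k) {j : Fin N} (hj : j ∈ inside k v₁ v₂) :
    (modulated k f v₂ j).det ≠ 0 := by
  have hjD : j ∉ leftOf k (-v₂ / 4) :=
    fun h => Finset.disjoint_left.1 (disjoint_leftOf_inside k v₁ v₂) h hj
  rw [modulated, Matrix.det_smul]
  exact mul_ne_zero (pow_ne_zero _ (pow_ne_zero _ (blaschke_ne_zero fun i hi =>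
    ⟨fun h => hjD (hk h ▸ hi), star_ne_of_im_pos hk_im j i⟩))) (hf j)
end Asymptotics

section Localization

variable {N : ℕ} {k : Fin N → ℂ} {x₁ x₂ v₁ v₂ : ℝ}

/-- The basic solution for the full data, multiplied by `a_{Δ_I⁻}^{σ₄}`, is the basic solution for
the reduced data up to a left factor `I + ∑ Y_a / (z - p_a)`, where the sum runs over the excluded
poles and the `Y_a` decay exponentially. -/
theorem exists_localization (hk : Function.Injective k) (hk_im : ∀ j, 0 < (k j).im) (x₁ x₂ : ℝ)
    (hv : v₁ ≤ v₂) {μ : ℝ} (hμ : ∀ j ∈ outside k v₁ v₂,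
      μ ≤ (k j).im * Metric.infDist (k j).re (velocityInterval v₁ v₂)) (K : ℝ) :
    ∃ C T : ℝ, 0 ≤ C ∧ 0 < T ∧ ∀ f : Fin N → Matrix (Fin 2) (Fin 2) ℂ,
      (∀ j, (f j).det ≠ 0) → (∀ j, frobNorm (f j) ≤ K ∧ frobNorm ((f j)⁻¹) ≤ K) →
      ∀ x t : ℝ, T ≤ t → (x, t) ∈ cone x₁ x₂ v₁ v₂ →
      (leftOf k (-x / (4 * t)) =
        leftOf k (-v₂ / 4) ∪ (leftOf k (-x / (4 * t)) ∩ inside k v₁ v₂)) ∧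
      ∀ M M' : ℂ → Mat4, IsRHSolution k f Finset.univ ∅ x t M →
        IsRHSolution k (modulated k f v₂) (inside k v₁ v₂) ∅ x t M' →
      ∃ Y : Fin N ⊕ Fin N → Mat4, (∀ a, ‖Y a‖ ≤ C * Real.exp (-8 * μ * t)) ∧
        (∀ a, Sum.elim id id a ∈ inside k v₁ v₂ → Y a = 0) ∧
        ∀ z ∉ poleSet k Finset.univ, M z * sigmaPow (blaschke k (leftOf k (-v₂ / 4)) z) =
          partialFractions (polePoint k) 1 Y z * M' z := by
  classical
  obtain ⟨C₁, hC₁, hres⟩ := exists_norm_residueMatrix_le k K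
  obtain ⟨T, hT, hside⟩ := exists_time_leftOf k x₁ x₂ hv
  obtain ⟨C₂, hC₂, hfac⟩ := exists_factorization (𝔸 := Mat4) mat4_eq_zero
    (fun _ _ h => mul_eq_one_comm.1 h) (polePoint k) Sum.swap C₁
  -- the factor lost because `k₀` is only within `O(1 / t)` of the interval
  set B : ℝ := ∑ j, Real.exp (2 * (k j).im * max |x₁| |x₂|) with hB
  have hC : 0 ≤ C₂ * (C₁ * B) := by positivity
  refine ⟨C₂ * (C₁ * B), T, hC, hT, fun f hf hfK x t ht hxt => ?_⟩
  have ht0 : 0 < t := hT.trans_le ht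
  have hsplit := leftOf_eq_union (hside x t ht hxt)
  refine ⟨hsplit, fun M M' hM hM' => ?_⟩
  set Δ := leftOf k (-x / (4 * t)) with hΔ
  set Δ' := Δ ∩ inside k v₁ v₂ with hΔ'
  have hΔ'sub : Δ' ⊆ inside k v₁ v₂ := Finset.inter_subset_right
  have hdis : Disjoint (leftOf k (-v₂ / 4)) Δ' := (disjoint_leftOf_inside k v₁ v₂).mono_right hΔ'sub
  have hsol := hM.mul_sigmaPow hk hk_im (fun j _ => hf j) (Finset.subset_univ Δ)
  have hsol' := hM'.mul_sigmaPow hk hk_im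
    (fun j hj => modulated_det_ne_zero hk_im hf hk hj) hΔ'sub
  -- with `Δ = Δ_{k₀}⁻` all residue data are bounded, uniformly in `(x, t)`
  set A := poleData k f Finset.univ Δ x t with hA
  set A' := poleData k (modulated k f v₂) (inside k v₁ v₂) Δ' x t with hA'
  have hAnorm : ∀ a, ‖A a‖ ≤ C₁ * Real.exp (-2 * (k (Sum.elim id id a)).im *
      |x + 4 * t * (k (Sum.elim id id a)).re|) := by
    rintro (j | j)
    · simpa [hA, poleData, poleMatrix] using hres f hfK x t ht0 j
    · simpa [hA, poleData, poleMatrix] using hres f hfK x t ht0 j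
  have hAK : ∀ a, ‖A a‖ ≤ C₁ := fun a => (hAnorm a).trans
    (mul_le_of_le_one_right hC₁ (Real.exp_le_one_iff.2 (by
      have := mul_nonneg (hk_im (Sum.elim id id a)).le
        (abs_nonneg (x + 4 * t * (k (Sum.elim id id a)).re))
      linarith)))
  have hin : ∀ j ∈ inside k v₁ v₂, poleMatrix k (modulated k f v₂) (inside k v₁ v₂) Δ' x t j =
      poleMatrix k f Finset.univ Δ x t j := fun j hj => by
    rw [poleMatrix_modulated hk_im hf hk hΔ'sub x t hj, ← hsplit]
  obtain ⟨Y, hY0, hYn, hYM⟩ := hfac {a | Sum.elim id id a ∈ inside k v₁ v₂} A A'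
    (isSchwarzData_poleData hk hk_im f Finset.univ Δ x t)
    (isSchwarzData_poleData hk hk_im _ _ Δ' x t) hAK
    (by rintro (j | j) hj <;> exact hj)
    (by rintro (j | j) hj
        · exact hin j hj
        · exact congrArg (fun X => -star X) (hin j hj))
    (by rintro (j | j) hj
        · have hj' : j ∉ inside k v₁ v₂ := hj
          simp [hA', poleData, poleMatrix, hj']
        · have hj' : j ∉ inside k v₁ v₂ := hj
          simp [hA', poleData, poleMatrix, hj'])
    _ _ ((isRHSolution_iff hk hk_im).1 hsol).2 ((isRHSolution_iff hk hk_im).1 hsol').2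
  refine ⟨Y, fun a => ?_, hY0, fun z hz => ?_⟩
  · by_cases ha : Sum.elim id id a ∈ inside k v₁ v₂
    · rw [hY0 a ha, norm_zero]
      exact mul_nonneg hC (Real.exp_pos _).le
    · have hAa := hAnorm a
      generalize Sum.elim id id a = j at ha hAa
      have hj' : j ∈ outside k v₁ v₂ := by simpa [inside, outside] using ha
      have h1 := le_abs_of_mem_cone ht0.le hxt (k j).re
      have h2 := hμ j hj'
      have h3 : -2 * (k j).im * |x + 4 * t * (k j).re| ≤
          2 * (k j).im * max |x₁| |x₂| + -8 * μ * t := by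
        have h4 := mul_le_mul_of_nonneg_left h1 (hk_im j).le
        have h5 := mul_le_mul_of_nonneg_right h2 ht0.le
        linarith
      calc ‖Y a‖ ≤ C₂ * ‖A a‖ := hYn a
        _ ≤ C₂ * (C₁ * Real.exp (-2 * (k j).im * |x + 4 * t * (k j).re|)) := by
            gcongr
        _ ≤ C₂ * (C₁ * Real.exp (2 * (k j).im * max |x₁| |x₂| + -8 * μ * t)) := by gcongr
        _ ≤ C₂ * (C₁ * (B * Real.exp (-8 * μ * t))) := by
            rw [Real.exp_add]
            gcongr
            exact Finset.single_le_sum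
              (f := fun j => Real.exp (2 * (k j).im * max |x₁| |x₂|))
              (fun _ _ => (Real.exp_pos _).le) (Finset.mem_univ j)
        _ = _ := by ring
  · -- cancel the common factor `a_{Δ'}^{σ₄}`
    have hz' : z ∉ Set.range (polePoint k) := by rwa [range_polePoint]
    have h := hYM z hz'
    have hne : blaschke k Δ' z ≠ 0 :=
      blaschke_ne_zero (notMem_poleSet (Finset.subset_univ Δ') hz)
    have h1 := congrArg (fun X => X * sigmaPow (blaschke k Δ' z)⁻¹) h
    simp only [mul_assoc, sigmaPow_mul] at h1
    rw [mul_inv_cancel₀ hne, sigmaPow_one, mul_one] at h1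
    rw [← h1, hsplit, blaschke_union hdis, mul_assoc, mul_inv_cancel₀ hne, mul_one]

lemma norm_partialFractions_sub_one_le {ι : Type*} [Fintype ι] {p : ι → ℂ} {Y : ι → Mat4}
    {D δ : ℝ} (hδ : 0 < δ) (hY : ∀ a, ‖Y a‖ ≤ D) {z : ℂ}
    (hz : ∀ a, Y a = 0 ∨ δ ≤ ‖z - p a‖) :
    ‖partialFractions p 1 Y z - 1‖ ≤ Fintype.card ι * (D / δ) := by
  rw [partialFractions, add_sub_cancel_left]
  refine (norm_sum_le_of_le (f := fun a => (z - p a)⁻¹ • Y a) (n := fun _ => D / δ)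
    Finset.univ fun a _ => ?_).trans_eq (by simp)
  have hD : 0 ≤ D := (norm_nonneg _).trans (hY a)
  rcases hz a with h | h
  · rw [h, smul_zero, norm_zero]
    positivity
  · rw [norm_smul, norm_inv, mul_comm, div_eq_mul_inv]
    gcongr
    exact hY a

lemma HasPotential.partialFractions_mul {ι : Type*} [Fintype ι] (p : ι → ℂ) (Y : ι → Mat4)
    {M : ℂ → Mat4} {q : Matrix (Fin 2) (Fin 2) ℂ} (h : HasPotential M q)
    (hM : Tendsto M (cocompact ℂ) (𝓝 1)) :
    HasPotential (fun z => partialFractions p 1 Y z * M z)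
      (q + (2 * Complex.I) • ∑ a, (Y a).toBlocks₁₂) := by
  have h1 : Tendsto (fun z : ℂ => (∑ a, (2 * Complex.I) • (z * (z - p a)⁻¹) • Y a) * M z)
      (cocompact ℂ) (𝓝 ((∑ a, (2 * Complex.I) • (1 : ℂ) • Y a) * 1)) :=
    (tendsto_finsetSum _ fun a _ =>
      ((tendsto_mul_sub_inv_cocompact (p a)).smul_const (Y a)).const_smul _).mul hM
  have hcont : Continuous fun A : Mat4 => A.toBlocks₁₂ :=
    continuous_id.matrix_submatrix Sum.inl Sum.inr
  have h2 := h.add ((hcont.tendsto _).comp h1)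
  have hlim : ((∑ a, (2 * Complex.I) • (1 : ℂ) • Y a) * 1 : Mat4).toBlocks₁₂ =
      (2 * Complex.I) • ∑ a, (Y a).toBlocks₁₂ := by
    ext i j
    simp [Matrix.toBlocks₁₂, Matrix.sum_apply, Finset.mul_sum]
  rw [hlim] at h2
  refine h2.congr fun z => ?_
  have h3 : (∑ a, (2 * Complex.I) • (z * (z - p a)⁻¹) • Y a) * M z =
      (2 * Complex.I * z) • ((∑ a, (z - p a)⁻¹ • Y a) * M z) := by
    rw [← Matrix.smul_mul, Finset.smul_sum]
    simp only [smul_smul, mul_assoc]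
  have h4 : partialFractions p 1 Y z * M z = M z + (∑ a, (z - p a)⁻¹ • Y a) * M z := by
    rw [partialFractions, add_mul, one_mul]
  simp only [Function.comp_apply]
  rw [h3, h4]
  ext i j
  simp [Matrix.toBlocks₁₂, mul_add]

end Localization

theorem mainTheorem3 {N : ℕ} (k : Fin N → ℂ) (hk : Function.Injective k)
    (hk_im : ∀ j, 0 < (k j).im) :
    -- every reflectionless problem has exactly one solution, and `q_sol` does not depend on `Δ`
    (∀ f : Fin N → Matrix (Fin 2) (Fin 2) ℂ, IsResidueData f →
      ∀ (J : Finset (Fin N)) (x t : ℝ), ∃ q : Matrix (Fin 2) (Fin 2) ℂ, ∀ Δ ⊆ J,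
        ∃ M : ℂ → Mat4, IsRHSolution k f J Δ x t M ∧ HasPotential M q ∧
          ∀ M' : ℂ → Mat4, IsRHSolution k f J Δ x t M' → Set.EqOn M' M (poleSet k J)ᶜ) ∧
    -- localization in the cone as `t → +∞`; the constants depend on the residue data only
    -- through the bound `K`
    (∀ x₁ x₂ v₁ v₂ : ℝ, x₁ ≤ x₂ → v₁ ≤ v₂ →
      -- `μ` is the minimum over the excluded eigenvalues (any real number if there are none)
      ∀ μ : ℝ, (∀ h : (outside k v₁ v₂).Nonempty, μ = (outside k v₁ v₂).inf' h
          fun j => (k j).im * Metric.infDist (k j).re (velocityInterval v₁ v₂)) →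
      ∀ K : ℝ,
        -- the Riemann-Hilbert solutions, uniformly away from the excluded poles
        (∀ δ : ℝ, 0 < δ → ∃ C T : ℝ, 0 < T ∧
          ∀ f : Fin N → Matrix (Fin 2) (Fin 2) ℂ, IsResidueData f →
          (∀ j, frobNorm (f j) ≤ K ∧ frobNorm ((f j)⁻¹) ≤ K) →
          ∀ x t : ℝ, T ≤ t → (x, t) ∈ cone x₁ x₂ v₁ v₂ →
          ∀ Δ Δ' : Finset (Fin N),
            -- either `Δ_{k₀}⁻` and its part in `Z(I)`, or `Δ_I⁻` and its (empty) part in `Z(I)`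
            (Δ = leftOf k (-x / (4 * t)) ∨ Δ = leftOf k (-v₂ / 4)) →
            Δ' = Δ ∩ inside k v₁ v₂ →
          ∀ M M' : ℂ → Mat4, IsRHSolution k f Finset.univ Δ x t M →
            IsRHSolution k (modulated k f v₂) (inside k v₁ v₂) Δ' x t M' →
          ∀ z ∉ poleSet k Finset.univ, (∀ p ∈ poleSet k (outside k v₁ v₂), δ ≤ ‖z - p‖) →
            ∃ E : Mat4, M z = (1 + E) * M' z ∧ frobNorm E ≤ C * Real.exp (-8 * μ * t)) ∧
        -- the soliton solutions
        (∃ C T : ℝ, 0 < T ∧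
          ∀ f : Fin N → Matrix (Fin 2) (Fin 2) ℂ, IsResidueData f →
          (∀ j, frobNorm (f j) ≤ K ∧ frobNorm ((f j)⁻¹) ≤ K) →
          ∀ x t : ℝ, T ≤ t → (x, t) ∈ cone x₁ x₂ v₁ v₂ →
          ∀ Δ Δ' : Finset (Fin N), Δ' ⊆ inside k v₁ v₂ →
          ∀ q q' : Matrix (Fin 2) (Fin 2) ℂ, IsSolitonSolution k f Finset.univ Δ x t q →
            IsSolitonSolution k (modulated k f v₂) (inside k v₁ v₂) Δ' x t q' →
            frobNorm (q - q') ≤ C * Real.exp (-8 * μ * t))) := by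
  refine ⟨fun f hf J x t =>
    exists_unique_isRHSolution hk hk_im (fun j _ => (hf j).2) x t, ?_⟩
  intro x₁ x₂ v₁ v₂ _ hv μ hμ K
  have hμ' : ∀ j ∈ outside k v₁ v₂,
      μ ≤ (k j).im * Metric.infDist (k j).re (velocityInterval v₁ v₂) := fun j hj => by
    rw [hμ ⟨j, hj⟩]
    exact Finset.inf'_le (fun j => (k j).im * Metric.infDist (k j).re (velocityInterval v₁ v₂)) hj
  obtain ⟨C, T, hC, hT, hloc⟩ := exists_localization hk hk_im x₁ x₂ hv hμ' K
  constructor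
  · intro δ hδ
    refine ⟨Fintype.card (Fin N ⊕ Fin N) * (C / δ), T, hT, ?_⟩
    intro f hf hfK x t ht hxt Δ Δ' hΔ hΔ' M M' hM hM' z hz hzδ
    have hfd := fun j => (hf j).2
    obtain ⟨hsplit, hMM⟩ := hloc f hfd hfK x t ht hxt
    have hdis := disjoint_leftOf_inside k v₁ v₂
    have hΔ'sub : Δ' ⊆ inside k v₁ v₂ := hΔ' ▸ Finset.inter_subset_right
    have hunion : Δ = leftOf k (-v₂ / 4) ∪ Δ' := by
      rcases hΔ with rfl | rfl
      · rw [hΔ']; exact hsplit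
      · rw [hΔ', Finset.disjoint_iff_inter_eq_empty.1 hdis, Finset.union_empty]
    obtain ⟨M₀, _, hM₀, -⟩ := exists_isRHSolution_empty hk hk_im f Finset.univ x t
    obtain ⟨M₀', _, hM₀', -⟩ :=
      exists_isRHSolution_empty hk hk_im (modulated k f v₂) (inside k v₁ v₂) x t
    obtain ⟨Y, hYn, hY0, hYM⟩ := hMM M₀ M₀' hM₀ hM₀'
    have hzin : z ∉ poleSet k (inside k v₁ v₂) := fun ⟨j, _, h⟩ => hz ⟨j, Finset.mem_univ j, h⟩
    have h1 : M z = M₀ z * sigmaPow (blaschke k Δ z) :=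
      (hM₀.mul_sigmaPow hk hk_im (fun j _ => hfd j) (Finset.subset_univ Δ)).unique hk hk_im hM hz
    have h2 : M' z = M₀' z * sigmaPow (blaschke k Δ' z) :=
      (hM₀'.mul_sigmaPow hk hk_im
        (fun j hj => modulated_det_ne_zero hk_im hfd hk hj) hΔ'sub).unique hk hk_im hM' hzin
    -- for both choices of `Δ` the factors `a_{Δ'}^{σ₄}` on the two sides agree
    refine ⟨partialFractions (polePoint k) 1 Y z - 1, ?_, ?_⟩
    · rw [h1, h2, add_sub_cancel, ← mul_assoc, ← hYM z hz, mul_assoc, sigmaPow_mul, hunion,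
        blaschke_union (hdis.mono_right hΔ'sub)]
    · rw [frobNorm_eq_norm]
      refine (norm_partialFractions_sub_one_le hδ hYn fun a => ?_).trans_eq (by ring)
      by_cases ha : Sum.elim id id a ∈ inside k v₁ v₂
      · exact Or.inl (hY0 a ha)
      · have ha' : Sum.elim id id a ∈ outside k v₁ v₂ := by simpa [inside, outside] using ha
        refine Or.inr (hzδ _ ⟨_, ha', ?_⟩)
        rcases a with j | j
        · exact Or.inl rfl
        · exact Or.inr rfl
  · refine ⟨2 * (Fintype.card (Fin N ⊕ Fin N) * C), T, hT, ?_⟩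
    intro f hf hfK x t ht hxt Δ Δ' hΔ'sub q q' hq hq'
    have hfd := fun j => (hf j).2
    obtain ⟨-, hMM⟩ := hloc f hfd hfK x t ht hxt
    obtain ⟨M₀, _, hM₀, -⟩ := exists_isRHSolution_empty hk hk_im f Finset.univ x t
    obtain ⟨M₀', _, hM₀', -⟩ :=
      exists_isRHSolution_empty hk hk_im (modulated k f v₂) (inside k v₁ v₂) x t
    obtain ⟨Y, hYn, -, hYM⟩ := hMM M₀ M₀' hM₀ hM₀'
    have h1 := (hq.hasPotential hk hk_im (fun j _ => hfd j) (Finset.subset_univ Δ)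
      hM₀).mul_sigmaPow (k := k) (leftOf k (-v₂ / 4))
    have h2 := (hq'.hasPotential hk hk_im (fun j hj => modulated_det_ne_zero hk_im hfd hk hj)
      hΔ'sub hM₀').partialFractions_mul (polePoint k) Y hM₀'.normalized
    have hqq := h1.unique h2 (by
      filter_upwards [eventually_notMem_range_cocompact (polePoint k)] with z hz
      exact hYM z (by rwa [← range_polePoint]))
    rw [frobNorm_eq_norm, hqq, add_sub_cancel_left, norm_smul]
    have h3 : ‖∑ a, (Y a).toBlocks₁₂‖ ≤
        Fintype.card (Fin N ⊕ Fin N) * (C * Real.exp (-8 * μ * t)) :=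
      (norm_sum_le_of_le (n := fun _ => C * Real.exp (-8 * μ * t)) Finset.univ fun a _ =>
        (norm_toBlocks₁₂_le _).trans (hYn a)).trans_eq (by simp)
    have h4 : ‖2 * Complex.I‖ = 2 := by simp
    rw [h4]
    linarith
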